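/- Consider last passage percolation on $\mathbb{Z}^2$: the vertices carry independent weights with a common law $\nu$ supported in $[0,\infty)$; an upright path is a finite nearest-neighbour path whose steps go one unit up or one unit to the right, and its weight is the sum of the weights of the vertices it visits. For lattice points $u\le v$ let $X_{u\to v}$ be the maximum weight of an upright path from $u$ to $v$; a path attaining it is a geodesic. Write $X_{m,n}=X_{(1,1)\to(m,n)}$ and $\mu=\lim_{n\to\infty} n^{-1}\mathbb{E}[X_{n,n}]$. The transversal fluctuation $\mathrm{TF}(\Gamma)$ of a path $\Gamma$ is the largest Euclidean distance of a vertex of $\Gamma$ from the diagonal $y=x$. Assume the following, where last passage values are considered at lattice points. (i) (Strong concavity of the limit shape and non-random fluctuations.) There are constants $\rho\in(0,1)$ and $G_1,G_2,g_1,g_2>0$ such that, for all large enough $r$ and all $x\in[-\rho,\rho]$, $X_{r(1-x),r(1+x)}$ is integrable and $$\mathbb{E}[X_{r(1-x),r(1+x)}]-\mu r\in\left[-G_1x^2r-g_1r^{1/3},\,-G_2x^2r-g_2r^{1/3}\right].$$ (ii) (Deviation estimates, uniform in direction.) For every $\delta>0$ there are $c,\theta_0,r_0\in(0,\infty)$ such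 that, for all $|x|\in[0,1-\delta]$, $r>r_0$ and $\theta>\theta_0$, writing $X=X_{r(1+x),r(1-x)}$, $$\mathbb{P}\left(X-\mathbb{E}[X]>\theta r^{1/3}\right)\le \exp\left(-c\min(\theta^{3/2},\theta r^{1/3})\right),\qquad \mathbb{P}\left(X-\mathbb{E}[X]<-\theta r^{1/3}\right)\le \exp\left(-c\theta^{3/2}\right).$$ For $0\le t\le s$ let $X^{r,s,t}$ be the maximum weight of all upright paths $\Gamma$ with $\mathrm{TF}(\Gamma)>(s+t)r^{2/3}$ that start at a lattice point of the line segment joining $(-tr^{2/3},tr^{2/3})$ and $(tr^{2/3},-tr^{2/3})$ and end at a lattice point of the line segment joining $(r-tr^{2/3},r+tr^{2/3})$ and $(r+tr^{2/3},r-tr^{2/3})$ (with $X^{r,s,t}=-\infty$ if there is no such path). Then: (a) There exist positive constants $r_0,s_0,c,c_2$ such that, for all $r>r_0$, $s>s_0$ and $0\le t\le s$, $$\mathbb{P}\left(X^{r,s,t}-\mu r>-c_2s^2r^{1/3}\right)<e^{-cs^3}.$$ (b) There exist constants $s_0,n_0$ and $c>0$ such that, for all $s>s_0$ and integers $n>n_0$,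 the probability that some geodesic from $(1,1)$ to $(n,n)$ has transversal fluctuation greater than $sn^{2/3}$ is at most $e^{-cs^3}$. -/

import Mathlib

open MeasureTheory ProbabilityTheory Filter Topology

noncomputable section

namespace LPP

/-- `p` to `q` is a single step of an upright path: one unit to the right or one unit up. -/
def Step (p q : ℤ × ℤ) : Prop := q = p + (1, 0) ∨ q = p + (0, 1)

/-- The list of successively visited vertices `γ` is an upright path from `u` to `v`. -/
def IsPath (u v : ℤ × ℤ) (γ : List (ℤ × ℤ)) : Prop :=
  γ.head? = some u ∧ γ.getLast? = some v ∧ γ.IsChain Step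

/-- The transversal fluctuation of a path: the largest Euclidean distance from one of its vertices
to the diagonal `y = x`. The distance from `(a, b)` to the diagonal is `|a - b| / √2`. -/
def transFluct (γ : List (ℤ × ℤ)) : ℝ :=
  sSup {d : ℝ | ∃ p ∈ γ, d = |(p.1 : ℝ) - (p.2 : ℝ)| / Real.sqrt 2}

/-- The lattice points of the anti-diagonal line segment joining
`(h - w, h + w)` and `(h + w, h - w)`. -/
def antiDiagSegment (h w : ℝ) : Set (ℤ × ℤ) :=
  {p | (p.1 : ℝ) + (p.2 : ℝ) = 2 * h ∧ |(p.1 : ℝ) - h| ≤ w}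

/-- The paths from the segment joining `(-t r^{2/3}, t r^{2/3})` and `(t r^{2/3}, -t r^{2/3})` to
the segment joining `(r - t r^{2/3}, r + t r^{2/3})` and `(r + t r^{2/3}, r - t r^{2/3})` whose
transversal fluctuation exceeds `(s + t) r^{2/3}`. -/
def farPaths (r s t : ℝ) : Set (List (ℤ × ℤ)) :=
  {γ | ∃ u ∈ antiDiagSegment 0 (t * r ^ ((2 : ℝ) / 3)),
       ∃ v ∈ antiDiagSegment r (t * r ^ ((2 : ℝ) / 3)),
         IsPath u v γ ∧ (s + t) * r ^ ((2 : ℝ) / 3) < transFluct γ}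

section Environment

variable {Ω : Type*} [MeasurableSpace Ω]

/-- `W` is an environment of independent vertex weights on `ℤ²`, each with law `ν`,
where `ν` is supported in `[0, ∞)`. -/
structure IsEnvironment (P : Measure Ω) (ν : Measure ℝ) (W : ℤ × ℤ → Ω → ℝ) : Prop where
  measurable : ∀ p, Measurable (W p)
  indep : iIndepFun W P
  law : ∀ p, P.map (W p) = ν
  nonneg : ν (Set.Iio 0) = 0

/-- The weight of a path: the sum of the weights of all the vertices that it visits. -/
def weight (W : ℤ × ℤ → Ω → ℝ) (γ : List (ℤ × ℤ)) (ω : Ω) : ℝ :=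
  (γ.map fun p => W p ω).sum

/-- The last passage value from `u` to `v`: the maximum weight of an upright path from `u` to `v`.
(There are finitely many such paths, and at least one if `u ≤ v`.) -/
def lastPassage (W : ℤ × ℤ → Ω → ℝ) (u v : ℤ × ℤ) (ω : Ω) : ℝ :=
  sSup {x : ℝ | ∃ γ, IsPath u v γ ∧ x = weight W γ ω}

/-- `γ` is a geodesic from `u` to `v`: an upright path of maximum weight. -/
def IsGeodesic (W : ℤ × ℤ → Ω → ℝ) (u v : ℤ × ℤ) (ω : Ω) (γ : List (ℤ × ℤ)) : Prop :=
  IsPath u v γ ∧ ∀ γ', IsPath u v γ' → weight W γ' ω ≤ weight W γ ω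

/-- The largest transversal fluctuation of a geodesic from `u` to `v`. -/
def geodesicFluct (W : ℤ × ℤ → Ω → ℝ) (u v : ℤ × ℤ) (ω : Ω) : ℝ :=
  sSup {d : ℝ | ∃ γ, IsGeodesic W u v ω γ ∧ d = transFluct γ}

/-- `X^{r,s,t}`: the maximum weight of the paths in `farPaths r s t`
(equal to `-∞` if there is no such path). -/
def farWeight (W : ℤ × ℤ → Ω → ℝ) (r s t : ℝ) (ω : Ω) : EReal :=
  ⨆ γ ∈ farPaths r s t, ((weight W γ ω : ℝ) : EReal)

/-- The growth rate `μ`: the limit of `E[X_n] / n`, where `X_n` is the last passage value from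
`(1, 1)` to `(n, n)`. -/
def growthRate (P : Measure Ω) (W : ℤ × ℤ → Ω → ℝ) : ℝ :=
  limUnder atTop fun n : ℕ => (∫ ω, lastPassage W (1, 1) ((n : ℤ), (n : ℤ)) ω ∂P) / (n : ℝ)

/-- Strong concavity of the limit shape and non-random fluctuations. The last passage value from
`(1, 1)` to `(r (1 - x), r (1 + x))` is considered whenever the latter is a lattice point. -/
def StrongConcavity (P : Measure Ω) (W : ℤ × ℤ → Ω → ℝ) : Prop :=
  ∃ ρ G₁ G₂ g₁ g₂ r₀ : ℝ, 0 < ρ ∧ ρ < 1 ∧ 0 < G₁ ∧ 0 < G₂ ∧ 0 < g₁ ∧ 0 < g₂ ∧ 0 < r₀ ∧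
    ∀ r x : ℝ, r₀ < r → |x| ≤ ρ → ∀ m n : ℤ, (m : ℝ) = r * (1 - x) → (n : ℝ) = r * (1 + x) →
      Integrable (lastPassage W (1, 1) (m, n)) P ∧
      (∫ ω, lastPassage W (1, 1) (m, n) ω ∂P) - growthRate P W * r ∈
        Set.Icc (-G₁ * x ^ 2 * r - g₁ * r ^ ((1 : ℝ) / 3))
          (-G₂ * x ^ 2 * r - g₂ * r ^ ((1 : ℝ) / 3))

/-- Moderate and large deviation estimates for last passage values, uniformly over directions
bounded away from the axes. The last passage value from `(1, 1)` to `(r (1 + x), r (1 - x))` is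
considered whenever the latter is a lattice point. -/
def DeviationEstimates (P : Measure Ω) (W : ℤ × ℤ → Ω → ℝ) : Prop :=
  ∀ δ : ℝ, 0 < δ → ∃ c θ₀ r₀ : ℝ, 0 < c ∧ 0 < θ₀ ∧ 0 < r₀ ∧
    ∀ r x θ : ℝ, r₀ < r → |x| ≤ 1 - δ → θ₀ < θ →
      ∀ m n : ℤ, (m : ℝ) = r * (1 + x) → (n : ℝ) = r * (1 - x) →
        P.real {ω | θ * r ^ ((1 : ℝ) / 3) <
            lastPassage W (1, 1) (m, n) ω - ∫ ω', lastPassage W (1, 1) (m, n) ω' ∂P} ≤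
          Real.exp (-c * min (θ ^ ((3 : ℝ) / 2)) (θ * r ^ ((1 : ℝ) / 3))) ∧
        P.real {ω | lastPassage W (1, 1) (m, n) ω - ∫ ω', lastPassage W (1, 1) (m, n) ω' ∂P <
            -θ * r ^ ((1 : ℝ) / 3)} ≤
          Real.exp (-c * θ ^ ((3 : ℝ) / 2))

end Environment

end LPP

end

noncomputable section

namespace LPP

/-! ### Combinatorics of upright paths. -/

section Paths

/-! A far path passes through a vertex `p` whose transversal displacement from its start `u` is of
order `s r^{2/3}`. Its weight is at most the passage value from `u` to `p` plus that from `p` to its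
end `v`. By strong concavity, such a detour costs order `s² r^{1/3}` in expectation, and moderate
deviations give probability `exp(-c s³)` for a fluctuation of that size. The difficulty is
uniformity: `u`, `p`, `v` range over far more points than a union bound allows.

To bound the passage value from `x` to `y` uniformly, extend the path backwards from `x` and
forwards from `y` to points `U`, `V` of a coarse grid. Superadditivity gives L(x,y) ≤ L(U,V) -
L(U,x) - L(y,V), where the pieces share no vertex. There are boundedly many pairs (U,V), so the
upper tail handles them (`UpperTail.coarseGood`). The pieces L(U,x) are bounded below for all `x` at
once by chaining through grids (`LowerTail.chainGood`, `ChainGood.exists_gridPt`), and the pieces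
L(y,V) in the same way after the reflection `p ↦ -p`.

The grid at scale `i` has longitudinal mesh `B a 8^i`, transversal mesh `a 4^i` and natural
deviation `a 2^i`. Such a deviation has probability about `exp(-c a)`. Scale `i` has of order
`32^(J-i)` points, so the allowed deviation is enlarged by a power of `3/2`: the probabilities
remain summable, with total of order `exp(-c a)`, and the errors still sum to order `a 2^J`. With `a
≈ (ε s)³` and `a 8^J ≈ r`, the coarsest meshes are of order `r` and `ε s r^{2/3}`, and the total
error is of order `ε² s² r^{1/3}`. For small `ε` the concavity loss beats this error, which proves
(a) (`weight_le_of_good`, `exists_farWeight_bound`).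

For (b), a geodesic weighs at least what the lower tail predicts, so with high probability it is not
a far path with `t = 0`. -/

theorem Step.lt {p q : ℤ × ℤ} (h : Step p q) : p < q := by
  obtain ⟨a, b⟩ := p
  rcases h with rfl | rfl <;> simp [Prod.lt_iff]

theorem IsPath.singleton (u : ℤ × ℤ) : IsPath u u [u] := by simp [IsPath]

theorem IsPath.append {u v v' w : ℤ × ℤ} {γ δ : List (ℤ × ℤ)} (hγ : IsPath u v γ)
    (hδ : IsPath v' w δ) (h : Step v v') : IsPath u w (γ ++ δ) := by
  obtain ⟨h1, h2, h3⟩ := hγ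
  obtain ⟨h4, h5, h6⟩ := hδ
  refine ⟨by simp [List.head?_append, h1], by simp [List.getLast?_append, h5], ?_⟩
  rw [List.isChain_append]
  refine ⟨h3, h6, fun x hx y hy => ?_⟩
  rw [h2] at hx; rw [h4] at hy
  simp only [Option.mem_def, Option.some.injEq] at hx hy
  exact hx ▸ hy ▸ h

theorem exists_isPath {u v : ℤ × ℤ} (h : u ≤ v) : ∃ γ, IsPath u v γ := by
  obtain ⟨a, b⟩ := u
  obtain ⟨a', b'⟩ := v
  obtain ⟨h1, h2⟩ := h
  simp only at h1 h2
  obtain ⟨m, rfl⟩ : ∃ m : ℕ, a' = a + m := ⟨(a' - a).toNat, by omega⟩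
  obtain ⟨n, rfl⟩ : ∃ n : ℕ, b' = b + n := ⟨(b' - b).toNat, by omega⟩
  clear h1 h2
  have right : ∀ m : ℕ, ∃ γ, IsPath (a, b) (a + m, b) γ := by
    intro m
    induction m with
    | zero => exact ⟨_, by simpa using IsPath.singleton (a, b)⟩
    | succ k ih =>
      obtain ⟨γ, hγ⟩ := ih
      exact ⟨_, hγ.append (IsPath.singleton (a + (k + 1 : ℕ), b))
        (Or.inl (by simp [add_assoc]))⟩
  induction n with
  | zero => simpa using right m
  | succ k ih =>
    obtain ⟨γ, hγ⟩ := ih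
    exact ⟨_, hγ.append (IsPath.singleton (a + m, b + (k + 1 : ℕ)))
      (Or.inr (by simp [add_assoc]))⟩

theorem IsPath.pairwise {u v : ℤ × ℤ} {γ : List (ℤ × ℤ)} (h : IsPath u v γ) :
    γ.Pairwise (· < ·) := by
  rw [← List.isChain_iff_pairwise]
  exact h.2.2.imp fun _ _ => Step.lt

theorem IsPath.le_mem {u v p : ℤ × ℤ} {γ : List (ℤ × ℤ)} (h : IsPath u v γ) (hp : p ∈ γ) :
    u ≤ p := by
  cases γ with
  | nil => simp at hp
  | cons x l =>
    have hx : x = u := by simpa using h.1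
    subst hx
    rcases List.mem_cons.1 hp with rfl | hp
    · exact le_rfl
    · exact ((List.pairwise_cons.1 h.pairwise).1 p hp).le

theorem IsPath.mem_le {u v p : ℤ × ℤ} {γ : List (ℤ × ℤ)} (h : IsPath u v γ) (hp : p ∈ γ) :
    p ≤ v := by
  have hne : γ ≠ [] := List.ne_nil_of_mem hp
  have hv : γ.getLast hne = v := by
    have := h.2.1
    rw [List.getLast?_eq_some_getLast hne] at this
    simpa using this
  have hpw := h.pairwise
  rw [← List.dropLast_append_getLast hne] at hp hpw
  rw [List.pairwise_append] at hpw
  rw [hv] at hp hpw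
  rcases List.mem_append.1 hp with hp | hp
  · exact (hpw.2.2 p hp v (by simp)).le
  · simp at hp; exact hp.le

/-- Splitting a path at one of its vertices. -/
theorem IsPath.split {u v p : ℤ × ℤ} {γ : List (ℤ × ℤ)} (h : IsPath u v γ) (hp : p ∈ γ) :
    ∃ δ ε : List (ℤ × ℤ), γ = δ ++ p :: ε ∧ IsPath u p (δ ++ [p]) ∧ IsPath p v (p :: ε) := by
  obtain ⟨δ, ε, rfl⟩ := List.append_of_mem hp
  refine ⟨δ, ε, rfl, ⟨?_, by simp, ?_⟩, ⟨by simp, ?_, ?_⟩⟩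
  · have := h.1
    cases δ <;> simpa using this
  · have := h.2.2
    rw [show δ ++ p :: ε = (δ ++ [p]) ++ ε by simp] at this
    exact (List.isChain_append.1 this).1
  · have := h.2.1
    rw [List.getLast?_append] at this
    cases hl : (p :: ε).getLast? with
    | none => simp at hl
    | some x => rw [hl] at this; simpa using this
  · exact (List.isChain_append.1 h.2.2).2.1

theorem IsPath.translate {u v : ℤ × ℤ} {γ : List (ℤ × ℤ)} (h : IsPath u v γ) (z : ℤ × ℤ) :
    IsPath (u + z) (v + z) (γ.map (· + z)) := by
  refine ⟨by simp [h.1], by simp [h.2.1], ?_⟩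
  rw [List.isChain_map]
  refine h.2.2.imp fun p q hpq => ?_
  rcases hpq with rfl | rfl
  · exact Or.inl (by abel)
  · exact Or.inr (by abel)

theorem IsPath.reflect {u v : ℤ × ℤ} {γ : List (ℤ × ℤ)} (h : IsPath u v γ) :
    IsPath (-v) (-u) (γ.map (- ·)).reverse := by
  refine ⟨by simp [h.2.1], by simp [h.1], ?_⟩
  rw [List.isChain_reverse, List.isChain_map]
  refine h.2.2.imp fun p q hpq => ?_
  rcases hpq with rfl | rfl
  · exact Or.inl (by abel)
  · exact Or.inr (by abel)

end Paths

/-! ### Superadditivity and symmetries of passage values. -/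

section Passage

variable {Ω : Type*} {W : ℤ × ℤ → Ω → ℝ} {ω : Ω} {u v w : ℤ × ℤ}

theorem weight_append (γ δ : List (ℤ × ℤ)) :
    weight W (γ ++ δ) ω = weight W γ ω + weight W δ ω := by
  simp [weight]

theorem weight_nonneg (h : ∀ p, 0 ≤ W p ω) (γ : List (ℤ × ℤ)) : 0 ≤ weight W γ ω :=
  List.sum_nonneg (by simp only [List.mem_map]; rintro _ ⟨p, -, rfl⟩; exact h p)

theorem weight_le_sum_abs {γ : List (ℤ × ℤ)} (h : IsPath u v γ) :
    weight W γ ω ≤ ∑ p ∈ Finset.Icc u v, |W p ω| := by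
  have hnd : γ.Nodup := h.pairwise.imp fun h => ne_of_lt h
  rw [weight, ← List.sum_toFinset _ hnd]
  refine (Finset.sum_le_sum fun p _ => le_abs_self _).trans
    (Finset.sum_le_sum_of_subset_of_nonneg (fun p hp => ?_) fun p _ _ => abs_nonneg _)
  rw [List.mem_toFinset] at hp
  exact Finset.mem_Icc.2 ⟨h.le_mem hp, h.mem_le hp⟩

theorem weight_le_lastPassage {γ : List (ℤ × ℤ)} (h : IsPath u v γ) :
    weight W γ ω ≤ lastPassage W u v ω :=
  le_csSup ⟨∑ p ∈ Finset.Icc u v, |W p ω|, by rintro _ ⟨γ, hγ, rfl⟩; exact weight_le_sum_abs hγ⟩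
    ⟨γ, h, rfl⟩

theorem lastPassage_le (huv : u ≤ v) {x : ℝ} (h : ∀ γ, IsPath u v γ → weight W γ ω ≤ x) :
    lastPassage W u v ω ≤ x := by
  obtain ⟨γ, hγ⟩ := exists_isPath huv
  exact csSup_le ⟨_, γ, hγ, rfl⟩ (by rintro _ ⟨γ, hγ, rfl⟩; exact h γ hγ)

theorem lastPassage_nonneg (h : ∀ p, 0 ≤ W p ω) : 0 ≤ lastPassage W u v ω :=
  Real.sSup_nonneg (by rintro _ ⟨γ, -, rfl⟩; exact weight_nonneg h γ)

theorem lastPassage_superadditive {v' : ℤ × ℤ} (huv : u ≤ v) (hvw : v' ≤ w) (h : Step v v') :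
    lastPassage W u v ω + lastPassage W v' w ω ≤ lastPassage W u w ω := by
  rw [← le_sub_iff_add_le]
  refine lastPassage_le huv fun γ hγ => ?_
  rw [le_sub_comm]
  refine lastPassage_le hvw fun δ hδ => ?_
  rw [le_sub_iff_add_le, add_comm, ← weight_append]
  exact weight_le_lastPassage (hγ.append hδ h)

theorem lastPassage_mono_right (h : ∀ p, 0 ≤ W p ω) (huv : u ≤ v) (hvw : v ≤ w) :
    lastPassage W u v ω ≤ lastPassage W u w ω := by
  refine lastPassage_le huv fun γ hγ => ?_
  obtain ⟨δ, hδ⟩ := exists_isPath hvw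
  cases δ with
  | nil => simp [IsPath] at hδ
  | cons x l =>
    have hx : x = v := by simpa using hδ.1
    subst hx
    cases l with
    | nil =>
      have : x = w := by simpa using hδ.2.1
      subst this
      exact weight_le_lastPassage hγ
    | cons y l =>
      have hc := hδ.2.2
      rw [List.isChain_cons_cons] at hc
      have hp : IsPath y w (y :: l) :=
        ⟨rfl, by simpa [List.getLast?_cons_cons] using hδ.2.1, hc.2⟩
      have := weight_le_lastPassage (W := W) (ω := ω) (hγ.append hp hc.1)
      rw [weight_append] at this
      linarith [weight_nonneg h (y :: l)]

theorem lastPassage_superadditive_diag (h : ∀ p, 0 ≤ W p ω) (huv : u ≤ v)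
    (hvw : v + (1, 1) ≤ w) :
    lastPassage W u v ω + lastPassage W (v + (1, 1)) w ω ≤ lastPassage W u w ω := by
  have hv : v ≤ v + (1, 0) := by simp [Prod.le_def]
  have h1 := lastPassage_mono_right h huv hv
  have h2 := lastPassage_superadditive (W := W) (ω := ω) (huv.trans hv) hvw
    (Or.inr (by ext <;> simp))
  linarith

/-- The weight of a path is at most the sum of the passage values to and from one of its
vertices. -/
theorem weight_le_add (h : ∀ p, 0 ≤ W p ω) {γ : List (ℤ × ℤ)} {p : ℤ × ℤ} (hγ : IsPath u v γ)
    (hp : p ∈ γ) : weight W γ ω ≤ lastPassage W u p ω + lastPassage W p v ω := by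
  obtain ⟨δ, ε, rfl, h1, h2⟩ := hγ.split hp
  have h3 := weight_le_lastPassage (W := W) (ω := ω) h1
  have h4 := weight_le_lastPassage (W := W) (ω := ω) h2
  rw [weight_append] at h3 ⊢
  have := weight_nonneg h [p]
  linarith

theorem weight_translate (z : ℤ × ℤ) (γ : List (ℤ × ℤ)) :
    weight (fun p => W (p + z)) γ ω = weight W (γ.map (· + z)) ω := by
  simp [weight, Function.comp_def]

theorem weight_reflect (γ : List (ℤ × ℤ)) :
    weight (fun p => W (-p)) γ ω = weight W (γ.map (- ·)).reverse ω := by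
  simp [weight, Function.comp_def, List.sum_reverse]

theorem lastPassage_translate (z : ℤ × ℤ) :
    lastPassage (fun p => W (p + z)) u v ω = lastPassage W (u + z) (v + z) ω := by
  unfold lastPassage
  congr 1
  ext x
  constructor
  · rintro ⟨γ, hγ, rfl⟩
    exact ⟨_, hγ.translate z, weight_translate z γ⟩
  · rintro ⟨γ, hγ, rfl⟩
    refine ⟨γ.map (· + -z), by simpa using hγ.translate (-z), ?_⟩
    rw [weight_translate]
    simp

theorem lastPassage_reflect :
    lastPassage (fun p => W (-p)) u v ω = lastPassage W (-v) (-u) ω := by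
  unfold lastPassage
  congr 1
  ext x
  constructor
  · rintro ⟨γ, hγ, rfl⟩
    exact ⟨_, hγ.reflect, weight_reflect γ⟩
  · rintro ⟨γ, hγ, rfl⟩
    refine ⟨(γ.map (- ·)).reverse, by simpa using hγ.reflect, ?_⟩
    rw [weight_reflect]
    simp

/-- The last passage value from `u` to `v` with the vertex `v` left out, with the path arriving
at `v` from the left. -/
def halfPassage (W : ℤ × ℤ → Ω → ℝ) (u v : ℤ × ℤ) (ω : Ω) : ℝ :=
  lastPassage W u (v - (1, 0)) ω

theorem halfPassage_add_lastPassage_le (huv : u ≤ v - (1, 0)) (hvw : v ≤ w) :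
    halfPassage W u v ω + lastPassage W v w ω ≤ lastPassage W u w ω :=
  lastPassage_superadditive huv hvw (Or.inl (by simp))

theorem halfPassage_superadditive (huv : u ≤ v - (1, 0)) (hvw : v ≤ w - (1, 0)) :
    halfPassage W u v ω + halfPassage W v w ω ≤ halfPassage W u w ω :=
  halfPassage_add_lastPassage_le huv hvw

/-- Forward pieces are half passages of the reflected environment, so one chaining argument serves
both directions. -/
theorem lastPassage_add_halfPassage_reflect_le (huv : u ≤ v) (hvw : v + (1, 0) ≤ w) :
    lastPassage W u v ω + halfPassage (fun p => W (-p)) (-w) (-v) ω ≤ lastPassage W u w ω := by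
  rw [halfPassage, lastPassage_reflect, neg_neg, show -(-v - (1, 0)) = v + (1, 0) by abel]
  exact lastPassage_superadditive huv hvw (Or.inl rfl)

end Passage

/-! ### Invariance in law. -/

section Law

variable {Ω : Type*} [MeasurableSpace Ω] {P : Measure Ω} {ν : Measure ℝ} {W W' : ℤ × ℤ → Ω → ℝ}

theorem IsEnvironment.precomp (hW : IsEnvironment P ν W) {φ : ℤ × ℤ → ℤ × ℤ}
    (hφ : φ.Injective) : IsEnvironment P ν (fun p => W (φ p)) :=
  ⟨fun _ => hW.measurable _, hW.indep.precomp hφ, fun _ => hW.law _, hW.nonneg⟩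

theorem IsEnvironment.ae_nonneg (hW : IsEnvironment P ν W) : ∀ᵐ ω ∂P, ∀ p, 0 ≤ W p ω := by
  rw [ae_all_iff]
  intro p
  have h : ∀ᵐ x ∂(P.map (W p)), 0 ≤ x := by
    rw [hW.law p, ae_iff]
    convert hW.nonneg using 2
    ext; simp
  exact ae_of_ae_map (hW.measurable p).aemeasurable h

theorem measurable_lastPassage_eval (u v : ℤ × ℤ) :
    Measurable (lastPassage (fun p (w : ℤ × ℤ → ℝ) => w p) u v) := by
  have h : lastPassage (fun p (w : ℤ × ℤ → ℝ) => w p) u v =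
      fun w => ⨆ γ : {γ // IsPath u v γ}, weight (fun p (w : ℤ × ℤ → ℝ) => w p) γ.1 w := by
    funext w
    unfold lastPassage
    rw [iSup]
    congr 1
    ext x
    simp [eq_comm]
  rw [h]
  refine Measurable.iSup fun γ => ?_
  unfold weight
  induction γ.1 with
  | nil => simp
  | cons p l ih =>
    simp only [List.map_cons, List.sum_cons]
    exact (measurable_pi_apply p).add ih

/-- Independence and the common marginal determine the joint law, namely the infinite product of
`ν`. -/
theorem IsEnvironment.measureReal_lastPassage_eq [IsProbabilityMeasure P]
    (hW : IsEnvironment P ν W) (hW' : IsEnvironment P ν W') (u v : ℤ × ℤ) {S : Set ℝ}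
    (hS : MeasurableSet S) :
    P.real {ω | lastPassage W u v ω ∈ S} = P.real {ω | lastPassage W' u v ω ∈ S} := by
  have key : ∀ V : ℤ × ℤ → Ω → ℝ, IsEnvironment P ν V →
      P {ω | lastPassage V u v ω ∈ S} = Measure.infinitePi (fun _ : ℤ × ℤ => ν)
        {w | lastPassage (fun p (w : ℤ × ℤ → ℝ) => w p) u v w ∈ S} := by
    intro V hV
    have hm : Measurable fun ω p => V p ω := measurable_pi_lambda _ hV.measurable
    have h := hV.indep.map_fun_eq_infinitePi_map₀ hm.aemeasurable
    simp_rw [hV.law] at h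
    rw [← h]
    exact (Measure.map_apply hm (measurable_lastPassage_eval u v hS)).symm
  rw [measureReal_def, measureReal_def, key W hW, key W' hW']

/-- The law of a last passage value depends only on the displacement. -/
theorem IsEnvironment.measureReal_lastPassage_translate [IsProbabilityMeasure P]
    (hW : IsEnvironment P ν W) (hW' : IsEnvironment P ν W') {u v u' v' : ℤ × ℤ}
    (h : v - u = v' - u') {S : Set ℝ} (hS : MeasurableSet S) :
    P.real {ω | lastPassage W u v ω ∈ S} = P.real {ω | lastPassage W' u' v' ω ∈ S} := by
  have h1 := (hW'.precomp (add_left_injective (u' - u))).measureReal_lastPassage_eq hW u v hS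
  simp_rw [lastPassage_translate] at h1
  rw [show v + (u' - u) = v' by rw [sub_eq_sub_iff_add_eq_add] at h; rw [← add_sub_assoc, h]; abel,
    show u + (u' - u) = u' by abel] at h1
  exact h1.symm

end Law

/-! ### Tail bounds near the diagonal, rescaled to deviation `a M` at distance of order `a M³`. -/

section Base

variable {Ω : Type*} [MeasurableSpace Ω] {P : Measure Ω} {ν : Measure ℝ} {W : ℤ × ℤ → Ω → ℝ}

theorem le_rpow_three_halves {x y : ℝ} (hx : 0 < x) (h : y ^ 2 ≤ x ^ 3) :
    y ≤ x ^ ((3 : ℝ) / 2) := by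
  have h2 : x ^ ((3 : ℝ) / 2) = Real.sqrt (x ^ 3) := by
    rw [Real.sqrt_eq_rpow, ← Real.rpow_natCast, ← Real.rpow_mul hx.le]; norm_num
  rw [h2]
  exact Real.le_sqrt_of_sq_le h

theorem cube_rpow_third {r : ℝ} (hr : 0 ≤ r) : (r ^ ((1 : ℝ) / 3)) ^ 3 = r := by
  rw [← Real.rpow_natCast, ← Real.rpow_mul hr]; norm_num

/-- At `x = 0` the concavity assumption bounds a nonnegative expectation by `μ n - g₂ n^{1/3}`.
Convergence to `μ` plays no role. -/
theorem growthRate_pos [IsProbabilityMeasure P] (hW : IsEnvironment P ν W)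
    (hconc : StrongConcavity P W) : 0 < growthRate P W := by
  obtain ⟨ρ, G₁, G₂, g₁, g₂, r₀, hρ, hρ1, hG1, hG2, hg1, hg2, hr0, h⟩ := hconc
  obtain ⟨n, hn⟩ := exists_nat_gt r₀
  have hn0 : (0 : ℝ) < n := hr0.trans hn
  have h1 := (h n 0 hn (by simpa using hρ.le) n n (by simp) (by simp)).2.2
  have h2 : 0 ≤ ∫ ω, lastPassage W (1, 1) ((n : ℤ), (n : ℤ)) ω ∂P :=
    integral_nonneg_of_ae (by filter_upwards [hW.ae_nonneg] with ω hω using lastPassage_nonneg hω)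
  have h3 : 0 < g₂ * (n : ℝ) ^ ((1 : ℝ) / 3) := by positivity
  have h4 : 0 < growthRate P W * n := by
    have : 0 ≤ -(-G₂ * 0 ^ 2 * n - g₂ * (n : ℝ) ^ ((1 : ℝ) / 3)) := by
      simp only [ne_eq, OfNat.ofNat_ne_zero, not_false_eq_true, zero_pow, mul_zero, zero_mul]
      linarith
    linarith
  exact pos_of_mul_pos_left h4 hn0.le

/-- Lower tail for last passage values from `(1, 1)` in directions close to the diagonal. -/
theorem lower_tail_base [IsProbabilityMeasure P]
    (hconc : StrongConcavity P W) (hdev : DeviationEstimates P W) :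
    ∃ G ρ : ℝ, 0 < G ∧ 0 < ρ ∧ ρ < 1 ∧ ∀ C : ℝ, 0 < C → ∃ c a₀ : ℝ, 0 < c ∧ 0 < a₀ ∧
      ∀ a M : ℝ, a₀ ≤ a → 0 < M → ∀ m n : ℤ, a₀ ≤ (m : ℝ) + n → (m : ℝ) + n ≤ C * (a * M ^ 3) →
        |(m : ℝ) - n| ≤ ρ * (m + n) →
        P.real {ω | lastPassage W (1, 1) (m, n) ω <
          growthRate P W / 2 * (m + n) - G * (((m : ℝ) - n) ^ 2 / (m + n)) - a * M} ≤
          Real.exp (-c * a) := by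
  obtain ⟨ρ, G₁, G₂, g₁, g₂, r₀, hρ, hρ1, hG1, hG2, hg1, hg2, hr0, h⟩ := hconc
  obtain ⟨c, θ₀, r₁, hc, hθ, hr1, hd⟩ := hdev (1 - ρ) (by linarith)
  refine ⟨G₁ / 2, ρ, by positivity, hρ, hρ1, fun C hC => ?_⟩
  set κ : ℝ := 1 / (4 * C) with hκ
  have hκ0 : 0 < κ := by positivity
  refine ⟨c * Real.sqrt κ, 2 * r₀ + 2 * r₁ + 1 + (4 * g₁ ^ 3 * C + 1) + (θ₀ ^ 3 / κ + 1), by positivity,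
    by positivity, fun a M ha hM m n hH hHC hD => ?_⟩
  have p1 : 0 < 4 * g₁ ^ 3 * C := by positivity
  have p2 : 0 < θ₀ ^ 3 / κ := by positivity
  have ha0 : 1 < a := by linarith
  set H : ℝ := (m : ℝ) + n with hHdef
  have hH0 : 1 < H := by linarith
  set r : ℝ := H / 2 with hr
  have hr' : 0 < r := by positivity
  set x : ℝ := ((n : ℝ) - m) / H with hx
  have hxr : r * x = (n - m) / 2 := by rw [hr, hx]; field_simp
  have hm : (m : ℝ) = r * (1 - x) := by rw [mul_sub, hxr, hr]; linarith
  have hn : (n : ℝ) = r * (1 + x) := by rw [mul_add, hxr, hr]; linarith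
  have hxρ : |x| ≤ ρ := by
    rw [hx, abs_div, abs_of_pos (zero_lt_one.trans hH0), div_le_iff₀ (by linarith), abs_sub_comm]
    exact hD
  have hE := (h r x (by linarith) hxρ m n hm hn).2.1
  set q : ℝ := r ^ ((1 : ℝ) / 3) with hq
  have hq0 : 0 < q := by positivity
  have hq3 : q ^ 3 = r := cube_rpow_third hr'.le
  -- Half of the deviation `a M` pays for the random fluctuation; the other half absorbs the
  -- non-random term `g₁ r^{1/3}`.
  set θ : ℝ := a * M / (2 * q) with hθd
  have hθ0 : 0 < θ := by positivity
  have hθq : θ * q = a * M / 2 := by rw [hθd]; field_simp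
  have hrC : 2 * r ≤ C * (a * M ^ 3) := by rw [hr]; linarith
  have hθ3 : κ * a ^ 2 ≤ θ ^ 3 := by
    rw [hθd, div_pow, mul_pow 2 q, hq3, le_div_iff₀ (by positivity), hκ]
    have : 1 / (4 * C) * a ^ 2 * (2 ^ 3 * r) = (a ^ 2 / C) * (2 * r) := by field_simp; ring
    rw [this]
    calc (a ^ 2 / C) * (2 * r) ≤ (a ^ 2 / C) * (C * (a * M ^ 3)) := by gcongr
      _ = (a * M) ^ 3 := by field_simp
  have haa : a ≤ a ^ 2 := le_self_pow₀ ha0.le two_ne_zero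
  have hθθ : θ₀ < θ := by
    refine lt_of_pow_lt_pow_left₀ 3 hθ0.le (lt_of_lt_of_le ?_ hθ3)
    have : θ₀ ^ 3 / κ < a ^ 2 := by linarith
    rw [div_lt_iff₀ hκ0] at this
    linarith
  have hgq : g₁ * q ≤ a * M / 2 := by
    refine le_of_pow_le_pow_left₀ (n := 3) (by norm_num) (by positivity) ?_
    rw [mul_pow, hq3]
    calc g₁ ^ 3 * r ≤ g₁ ^ 3 * (C * (a * M ^ 3) / 2) := by gcongr; linarith
      _ = (4 * g₁ ^ 3 * C) * (a * M ^ 3 / 8) := by ring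
      _ ≤ a ^ 2 * (a * M ^ 3 / 8) := by gcongr; linarith
      _ = _ := by ring
  have hdd := (hd r (-x) θ (by linarith) (by rw [abs_neg]; linarith) hθθ m n (by rw [hm]; ring)
    (by rw [hn]; ring)).2
  refine (measureReal_mono fun ω hω => ?_).trans (hdd.trans ?_)
  · simp only [Set.mem_ofPred_eq] at hω ⊢
    rw [← hq, neg_mul, hθq]
    have e1 : G₁ * x ^ 2 * r = G₁ / 2 * (((m : ℝ) - n) ^ 2 / H) := by
      rw [hx, hr]; field_simp; ring
    have e2 : growthRate P W * r = growthRate P W / 2 * H := by rw [hr]; ring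
    linarith
  · rw [Real.exp_le_exp, neg_mul, neg_mul, neg_le_neg_iff, mul_assoc]
    gcongr
    refine le_rpow_three_halves hθ0 ?_
    rw [mul_pow, Real.sq_sqrt hκ0.le]
    exact hθ3

/-- Upper tail for last passage values from `(1, 1)` in directions close to the diagonal. -/
theorem upper_tail_base [IsProbabilityMeasure P]
    (hconc : StrongConcavity P W) (hdev : DeviationEstimates P W) :
    ∃ G ρ : ℝ, 0 < G ∧ 0 < ρ ∧ ρ < 1 ∧ ∀ C : ℝ, 0 < C → ∃ c a₀ : ℝ, 0 < c ∧ 0 < a₀ ∧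
      ∀ a M : ℝ, a₀ ≤ a → 1 ≤ M → ∀ m n : ℤ, a₀ ≤ (m : ℝ) + n → (m : ℝ) + n ≤ C * (a * M ^ 3) →
        |(m : ℝ) - n| ≤ ρ * (m + n) →
        P.real {ω | growthRate P W / 2 * (m + n) - G * (((m : ℝ) - n) ^ 2 / (m + n)) + a * M <
          lastPassage W (1, 1) (m, n) ω} ≤ Real.exp (-c * a) := by
  obtain ⟨ρ, G₁, G₂, g₁, g₂, r₀, hρ, hρ1, hG1, hG2, hg1, hg2, hr0, h⟩ := hconc
  obtain ⟨c, θ₀, r₁, hc, hθ, hr1, hd⟩ := hdev (1 - ρ) (by linarith)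
  refine ⟨G₂ / 2, ρ, by positivity, hρ, hρ1, fun C hC => ?_⟩
  set κ : ℝ := 1 / C with hκ
  have hκ0 : 0 < κ := by positivity
  refine ⟨c * min (Real.sqrt κ) 1, 2 * r₀ + 2 * r₁ + 1 + (θ₀ ^ 3 / κ + 1), by positivity,
    by positivity, fun a M ha hM m n hH hHC hD => ?_⟩
  have p2 : 0 < θ₀ ^ 3 / κ := by positivity
  have ha0 : 1 < a := by linarith
  have hM0 : 0 < M := by linarith
  set H : ℝ := (m : ℝ) + n with hHdef
  have hH0 : 1 < H := by linarith
  set r : ℝ := H / 2 with hr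
  have hr' : 0 < r := by positivity
  set x : ℝ := ((n : ℝ) - m) / H with hx
  have hxr : r * x = (n - m) / 2 := by rw [hr, hx]; field_simp
  have hm : (m : ℝ) = r * (1 - x) := by rw [mul_sub, hxr, hr]; linarith
  have hn : (n : ℝ) = r * (1 + x) := by rw [mul_add, hxr, hr]; linarith
  have hxρ : |x| ≤ ρ := by
    rw [hx, abs_div, abs_of_pos (zero_lt_one.trans hH0), div_le_iff₀ (by linarith), abs_sub_comm]
    exact hD
  have hE := (h r x (by linarith) hxρ m n hm hn).2.2
  set q : ℝ := r ^ ((1 : ℝ) / 3) with hq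
  have hq0 : 0 < q := by positivity
  have hq3 : q ^ 3 = r := cube_rpow_third hr'.le
  set θ : ℝ := a * M / q with hθd
  have hθ0 : 0 < θ := by positivity
  have hθq : θ * q = a * M := by rw [hθd]; field_simp
  have hθ3 : κ * a ^ 2 ≤ θ ^ 3 := by
    rw [hθd, div_pow, hq3, le_div_iff₀ (by positivity), hκ]
    calc 1 / C * a ^ 2 * r = (a ^ 2 / C) * r := by field_simp
      _ ≤ (a ^ 2 / C) * (C * (a * M ^ 3)) := by gcongr; linarith
      _ = (a * M) ^ 3 := by field_simp
  have haa : a ≤ a ^ 2 := le_self_pow₀ ha0.le two_ne_zero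
  have hθθ : θ₀ < θ := by
    refine lt_of_pow_lt_pow_left₀ 3 hθ0.le (lt_of_lt_of_le ?_ hθ3)
    have : θ₀ ^ 3 / κ < a ^ 2 := by linarith
    rw [div_lt_iff₀ hκ0] at this
    linarith
  have hdd := (hd r (-x) θ (by linarith) (by rw [abs_neg]; linarith) hθθ m n (by rw [hm]; ring)
    (by rw [hn]; ring)).1
  refine (measureReal_mono fun ω hω => ?_).trans (hdd.trans ?_)
  · simp only [Set.mem_ofPred_eq] at hω ⊢
    rw [← hq, hθq]
    have e1 : G₂ * x ^ 2 * r = G₂ / 2 * (((m : ℝ) - n) ^ 2 / H) := by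
      rw [hx, hr]; field_simp; ring
    have e2 : growthRate P W * r = growthRate P W / 2 * H := by rw [hr]; ring
    have e3 : 0 < g₂ * q := by positivity
    linarith
  · rw [Real.exp_le_exp, neg_mul, neg_mul, neg_le_neg_iff, mul_assoc]
    gcongr
    rw [← hq, hθq]
    refine le_min ?_ ?_
    · refine (mul_le_mul_of_nonneg_right (min_le_left _ _) (by linarith)).trans ?_
      refine le_rpow_three_halves hθ0 ?_
      rw [mul_pow, Real.sq_sqrt hκ0.le]
      exact hθ3
    -- The large deviation branch equals `a M`, which is why `1 ≤ M` is required here.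
    · refine (mul_le_mul_of_nonneg_right (min_le_right _ _) (by linarith)).trans ?_
      rw [one_mul]
      exact le_mul_of_one_le_right (by linarith) hM

end Base

/-! ### Rotated coordinates. -/

/-- Twice the longitudinal coordinate of a lattice point. -/
def ht (p : ℤ × ℤ) : ℝ := (p.1 : ℝ) + p.2

/-- Twice the transversal coordinate of a lattice point. -/
def off (p : ℤ × ℤ) : ℝ := (p.1 : ℝ) - p.2

@[simp] theorem ht_neg (p : ℤ × ℤ) : ht (-p) = -ht p := by simp [ht]; ring
@[simp] theorem off_neg (p : ℤ × ℤ) : off (-p) = -off p := by simp [off]; ring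
theorem ht_sub (p q : ℤ × ℤ) : ht (p - q) = ht p - ht q := by simp [ht]; ring
theorem off_sub (p q : ℤ × ℤ) : off (p - q) = off p - off q := by simp [off]; ring

/-! ### Tail bounds between arbitrary points. -/

section Tails

variable {Ω : Type*} [MeasurableSpace Ω]

/-- Lower tail bounds for last passage values in directions close to the diagonal, with
deviation `a M` at distance at most of order `a M ^ 3`. -/
def LowerTail (P : Measure Ω) (W : ℤ × ℤ → Ω → ℝ) (lam G ρ : ℝ) : Prop :=
  ∀ C : ℝ, 0 < C → ∃ c a₀ : ℝ, 0 < c ∧ 0 < a₀ ∧ ∀ a M : ℝ, a₀ ≤ a → 0 < M → ∀ u v : ℤ × ℤ,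
    a₀ ≤ ht (v - u) → ht (v - u) ≤ C * (a * M ^ 3) → |off (v - u)| ≤ ρ * ht (v - u) →
    P.real {ω | halfPassage W u v ω <
      lam * ht (v - u) - G * (off (v - u) ^ 2 / ht (v - u)) - a * M} ≤ Real.exp (-c * a)

/-- Upper tail bounds for last passage values in all directions. -/
def UpperTail (P : Measure Ω) (W : ℤ × ℤ → Ω → ℝ) (lam G : ℝ) : Prop :=
  ∀ C : ℝ, 0 < C → ∃ c a₀ : ℝ, 0 < c ∧ 0 < a₀ ∧ ∀ a M : ℝ, a₀ ≤ a → 1 ≤ M → ∀ u v : ℤ × ℤ,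
    u ≤ v → a₀ ≤ ht (v - u) → ht (v - u) ≤ C * (a * M ^ 3) →
    P.real {ω | lam * ht (v - u) - G * (off (v - u) ^ 2 / ht (v - u)) + a * M <
      lastPassage W u v ω} ≤ 2 * Real.exp (-c * a)

variable {P : Measure Ω} [IsProbabilityMeasure P] {ν : Measure ℝ} {W V : ℤ × ℤ → Ω → ℝ}

theorem measureReal_mono_of_ae {p : Ω → Prop} {s t : Set Ω} (hp : ∀ᵐ ω ∂P, p ω)
    (h : ∀ ω, p ω → ω ∈ s → ω ∈ t) : P.real s ≤ P.real t :=
  ENNReal.toReal_mono (measure_ne_top _ _)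
    (measure_mono_ae (by filter_upwards [hp] with ω hω using h ω hω))

theorem exists_lowerTail (hW : IsEnvironment P ν W) (hconc : StrongConcavity P W)
    (hdev : DeviationEstimates P W) :
    ∃ G ρ : ℝ, 0 < G ∧ 0 < ρ ∧ ρ < 1 ∧ ∀ V : ℤ × ℤ → Ω → ℝ, IsEnvironment P ν V →
      LowerTail P V (growthRate P W / 2) G ρ := by
  obtain ⟨G, ρ, hG, hρ, hρ1, h⟩ := lower_tail_base hconc hdev
  refine ⟨G, ρ, hG, hρ, hρ1, fun V hV C hC => ?_⟩
  obtain ⟨c, a₀, hc, ha0, h⟩ := h C hC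
  refine ⟨c, a₀, hc, ha0, fun a M ha hM u v hH hHC hD => ?_⟩
  obtain ⟨m, n, hmn⟩ : ∃ m n : ℤ, v - u = (m, n) := ⟨_, _, rfl⟩
  rw [hmn] at hH hHC hD ⊢
  simp only [ht, off] at hH hHC hD ⊢
  refine le_trans ?_ (h a M ha hM m n hH hHC hD)
  have hH0 : (0 : ℝ) < m + n := ha0.trans_le hH
  have hD' : |(m : ℝ) - n| < m + n := hD.trans_lt (mul_lt_of_lt_one_left hH0 hρ1)
  rw [abs_lt] at hD'
  have hm : 0 < m := by exact_mod_cast (by linarith : (0 : ℝ) < m)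
  have hn : 0 < n := by exact_mod_cast (by linarith : (0 : ℝ) < n)
  -- With `v - (1, 0)` as endpoint the displacement is that of `(1, 1)` to `(m, n + 1)`, whose
  -- passage value dominates that to `(m, n)`.
  refine (hV.measureReal_lastPassage_translate hW (u' := (1, 1)) (v' := (m, n + 1)) ?_
    measurableSet_Iio).le.trans (measureReal_mono_of_ae hW.ae_nonneg fun ω hω h => ?_)
  · rw [sub_right_comm, hmn]; ext <;> simp
  · refine lt_of_le_of_lt (lastPassage_mono_right hω ?_ ?_) h
    · simp only [Prod.le_def]; omega
    · simp [Prod.le_def]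

/-- Directions near the axes lie outside the assumptions. Appending a long diagonal segment from `v
+ (1, 1)` to `d` turns the direction from `u` to `d` towards the diagonal. The value from `u` to `v`
is then at most the value from `u` to `d` (upper tail) minus that of the diagonal piece (lower
tail). The longer distance only divides the concavity constant. -/
theorem exists_upperTail (hW : IsEnvironment P ν W) (hconc : StrongConcavity P W)
    (hdev : DeviationEstimates P W) :
    ∃ G : ℝ, 0 < G ∧ ∀ V : ℤ × ℤ → Ω → ℝ, IsEnvironment P ν V →
      UpperTail P V (growthRate P W / 2) G := by
  obtain ⟨G₁, ρ₁, hG1, hρ1, -, h1⟩ := lower_tail_base hconc hdev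
  obtain ⟨G₂, ρ, hG2, hρ, -, h2⟩ := upper_tail_base hconc hdev
  have hlam := growthRate_pos hW hconc
  set lam := growthRate P W / 2 with hlamd
  obtain ⟨k, hk⟩ := exists_nat_gt (1 / ρ)
  have hk0 : (0 : ℝ) < k := lt_trans (by positivity) hk
  have hkρ : 1 ≤ k * ρ := by rw [div_lt_iff₀ hρ] at hk; exact hk.le
  refine ⟨G₂ / (2 * k + 3), by positivity, fun V hV C hC => ?_⟩
  obtain ⟨c₁, a₁, hc1, ha1, h1⟩ := h1 (4 * (2 * k + 3) * C) (by positivity)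
  obtain ⟨c₂, a₂, hc2, ha2, h2⟩ := h2 (4 * (2 * k + 3) * C) (by positivity)
  refine ⟨min c₁ c₂ / 4, 4 * a₁ + 4 * a₂ + 2 + 4 * lam + a₁ / k, by positivity, by positivity,
    fun a M ha hM u v huv hH hHC => ?_⟩
  have hpk : 0 < a₁ / k := by positivity
  have hlam0 : 0 < lam := by positivity
  obtain ⟨m, n, hmn⟩ : ∃ m n : ℤ, v - u = (m, n) := ⟨_, _, rfl⟩
  rw [hmn] at hH hHC ⊢
  simp only [ht, off] at hH hHC ⊢
  have hmn0 : 0 ≤ m ∧ 0 ≤ n := by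
    have : (0 : ℤ × ℤ) ≤ (m, n) := by rw [← hmn]; exact sub_nonneg.2 huv
    exact this
  have hm : (0 : ℝ) ≤ m := by exact_mod_cast hmn0.1
  have hn : (0 : ℝ) ≤ n := by exact_mod_cast hmn0.2
  have hDm : |(m : ℝ) - n| ≤ m + n := by rw [abs_le]; constructor <;> linarith
  set N : ℤ := k * (m + n) with hN
  set d : ℤ × ℤ := v + (N, N) with hd
  set H : ℝ := (m : ℝ) + n with hHd
  have hNr : (N : ℝ) = k * H := by rw [hN, hHd]; push_cast; ring
  have ha0 : 2 ≤ a := by linarith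
  have hH2 : 2 ≤ H := by linarith
  have hM3 : 1 ≤ M ^ 3 := one_le_pow₀ hM
  have hak : a₁ ≤ k * H := by
    have : a₁ / k ≤ H := by linarith
    rwa [div_le_iff₀ hk0, mul_comm] at this
  have hkH : 0 ≤ k * H := by positivity
  have hscale : 4 * (2 * k + 3) * C * (a / 4 * M ^ 3) = (2 * k + 3) * (C * (a * M ^ 3)) := by ring
  have hkC : k * H ≤ k * (C * (a * M ^ 3)) := by gcongr
  have hlin : (2 * k + 3) * (C * (a * M ^ 3)) =
    2 * (k * (C * (a * M ^ 3))) + 3 * (C * (a * M ^ 3)) := by ring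
  have hHρ : H ≤ ρ * (2 * (k * H)) := by
    have := mul_le_mul_of_nonneg_right hkρ (by linarith : 0 ≤ H)
    linarith
  have b1 := h1 (a / 4) M (by linarith) (by linarith) N N (by rw [hNr]; linarith)
    (by rw [hNr, hscale, hlin]; linarith)
    (by rw [sub_self, abs_zero, hNr]; positivity)
  have eH : ((m + N + 1 : ℤ) : ℝ) + ((n + N + 1 : ℤ) : ℝ) = H + 2 * (k * H) + 2 := by
    push_cast; rw [hNr, hHd]; ring
  have eD : ((m + N + 1 : ℤ) : ℝ) - ((n + N + 1 : ℤ) : ℝ) = m - n := by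
    push_cast; ring
  have b2 := h2 (a / 4) M (by linarith) hM (m + N + 1) (n + N + 1)
    (by rw [eH]; linarith) (by rw [eH, hscale, hlin]; linarith) (by rw [eH, eD, mul_add, mul_add]; linarith [mul_nonneg hρ.le (by linarith : 0 ≤ H)])
  rw [eH, eD] at b2
  rw [hNr] at b1
  have hN1 : (1 : ℤ) ≤ N := by
    have hpos : (0 : ℝ) < N := by rw [hNr]; positivity
    have : (0 : ℤ) < N := by exact_mod_cast hpos
    omega
  have t1 := hV.measureReal_lastPassage_translate hW (u := v + (1, 1)) (v := d) (u' := (1, 1))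
    (v' := (N, N)) (by rw [hd]; ext <;> simp) (measurableSet_Iio (a := lam * (k * H + k * H) -
      G₁ * ((k * H - k * H) ^ 2 / (k * H + k * H)) - a / 4 * M))
  have t2 := hV.measureReal_lastPassage_translate hW (u := u) (v := d) (u' := (1, 1))
    (v' := (m + N + 1, n + N + 1)) (by
      rw [hd, show v + (N, N) - u = (v - u) + (N, N) by abel, hmn]; ext <;> simp)
    (measurableSet_Ioi (a := lam * (H + 2 * (k * H) + 2) -
      G₂ * (((m : ℝ) - n) ^ 2 / (H + 2 * (k * H) + 2)) + a / 4 * M))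
  simp only [Set.mem_Iio, Set.mem_Ioi] at t1 t2
  rw [← t1] at b1
  rw [← t2] at b2
  have e1 : Real.exp (-c₁ * (a / 4)) ≤ Real.exp (-(min c₁ c₂ / 4) * a) := by
    rw [Real.exp_le_exp]
    linarith [mul_le_mul_of_nonneg_right (min_le_left c₁ c₂) (by linarith : 0 ≤ a)]
  have e2 : Real.exp (-c₂ * (a / 4)) ≤ Real.exp (-(min c₁ c₂ / 4) * a) := by
    rw [Real.exp_le_exp]
    linarith [mul_le_mul_of_nonneg_right (min_le_right c₁ c₂) (by linarith : 0 ≤ a)]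
  refine (measureReal_mono_of_ae hV.ae_nonneg fun ω hω h => ?_).trans
    (((measureReal_union_le _ _).trans (add_le_add (b1.trans e1) (b2.trans e2))).trans_eq (by ring))
  by_contra hcon
  simp only [Set.mem_union, Set.mem_ofPred_eq, not_or, not_lt] at hcon h
  obtain ⟨g1, g2⟩ := hcon
  have hs := lastPassage_superadditive_diag hω huv (w := d) (by
    rw [hd]; exact add_le_add_right (by simp [Prod.le_def, hN1]) v)
  have q1 : G₂ / (2 * k + 3) * (((m : ℝ) - n) ^ 2 / H) ≤
      G₂ * (((m : ℝ) - n) ^ 2 / (H + 2 * (k * H) + 2)) := by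
    have : G₂ / (2 * k + 3) * (((m : ℝ) - n) ^ 2 / H) =
        G₂ * (((m : ℝ) - n) ^ 2 / ((2 * k + 3) * H)) := by field_simp
    rw [this]
    gcongr
    linarith
  -- The extra height 2 comes from the base point `(1, 1)`; its drift uses up the half of `a M` left
  -- by the two tails.
  have q2 : lam * 2 ≤ a / 2 * M := by
    have := mul_le_mul_of_nonneg_left hM (by linarith : 0 ≤ a / 2)
    linarith
  have q3 : G₁ * ((k * H - k * H) ^ 2 / (k * H + k * H)) = 0 := by simp
  rw [q3] at g1
  linarith

end Tails

/-! ### Grids adapted to the scaling. -/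

section Grid

/-- The points of a grid with longitudinal spacing `h` and transversal spacing `w`. -/
def gridPt (h w k l : ℤ) : ℤ × ℤ := (k * h + l * w, k * h - l * w)

/-- A point of the grid which lies below `p`, at longitudinal distance between `h` and `2 h`. -/
def gridProj (h w : ℤ) (p : ℤ × ℤ) : ℤ × ℤ :=
  gridPt h w ((p.1 + p.2) / (2 * h) - 1) ((p.1 - p.2) / (2 * w))

theorem ht_gridPt (h w k l : ℤ) : ht (gridPt h w k l) = 2 * (k * h) := by
  simp [ht, gridPt]; ring

theorem off_gridPt (h w k l : ℤ) : off (gridPt h w k l) = 2 * (l * w) := by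
  simp [off, gridPt]; ring

theorem neg_gridPt (h w k l : ℤ) : -gridPt h w k l = gridPt h w (-k) (-l) := by
  ext <;> simp [gridPt] <;> ring

/-- The shift by `-1` in `gridProj` keeps the height difference at least `2 h`, so that for `w`
small compared with `h` the direction stays close to the diagonal. -/
theorem gridProj_bounds {h w : ℤ} (hh : 0 < h) (hw : 0 < w) (p : ℤ × ℤ) :
    2 * (h : ℝ) ≤ ht (p - gridProj h w p) ∧ ht (p - gridProj h w p) ≤ 4 * h ∧
      0 ≤ off (p - gridProj h w p) ∧ off (p - gridProj h w p) ≤ 2 * w := by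
  have e1 : ht (p - gridProj h w p) = ((p.1 + p.2) % (2 * h) + 2 * h : ℤ) := by
    rw [ht_sub, gridProj, ht_gridPt, Int.emod_def]; simp [ht]; ring
  have e2 : off (p - gridProj h w p) = ((p.1 - p.2) % (2 * w) : ℤ) := by
    rw [off_sub, gridProj, off_gridPt, Int.emod_def]; simp [off]; ring
  have h1 := Int.emod_nonneg (p.1 + p.2) (b := 2 * h) (by omega)
  have h2 := Int.emod_lt_of_pos (p.1 + p.2) (b := 2 * h) (by omega)
  have h3 := Int.emod_nonneg (p.1 - p.2) (b := 2 * w) (by omega)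
  have h4 := Int.emod_lt_of_pos (p.1 - p.2) (b := 2 * w) (by omega)
  rw [e1, e2]
  refine ⟨?_, ?_, ?_, ?_⟩ <;> norm_cast <;> omega

theorem le_sub_of_ht_off {u v : ℤ × ℤ} (h0 : 0 ≤ off (v - u)) (h1 : 2 ≤ ht (v - u))
    (h2 : off (v - u) ≤ ht (v - u)) : u ≤ v - (1, 0) := by
  simp only [off, ht, Prod.fst_sub, Prod.snd_sub] at h0 h1 h2
  norm_cast at h0 h1 h2
  simp only [Prod.le_def, Prod.fst_sub, Prod.snd_sub]
  omega

theorem le_of_le_sub {u v : ℤ × ℤ} (h : u ≤ v - (1, 0)) : u ≤ v :=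
  h.trans (by simp [Prod.le_def])

end Grid

/-! ### Chaining through the scales. -/

section Chain

variable {Ω : Type*}

/-- At every scale, last passage values from the projection of a grid point to this grid point are
not much smaller than expected. -/
def ChainGood (W : ℤ × ℤ → Ω → ℝ) (lam G : ℝ) (B a J K : ℕ) (ω : Ω) : Prop :=
  ∀ i < J, ∀ k l : ℤ, |k| ≤ 11 * 8 ^ (J - i) → |l| ≤ (K + 3) * 4 ^ (J - i) →
    ∀ q p : ℤ × ℤ, q = gridPt (B * a * 8 ^ i) (a * 4 ^ i) k l →
      p = gridProj (B * a * 8 ^ (i + 1)) (a * 4 ^ (i + 1)) q →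
      lam * ht (q - p) - G * (off (q - p) ^ 2 / ht (q - p)) -
        a * (3 / 2) ^ (J - 1 - i) * 2 ^ (i + 1) ≤ halfPassage W p q ω

/-- Last passage values between points of the coarsest grid are not much larger than expected. -/
def CoarseGood (W : ℤ × ℤ → Ω → ℝ) (lam G : ℝ) (B a J K : ℕ) (ω : Ω) : Prop :=
  ∀ k l k' l' : ℤ, |k| ≤ 11 → |l| ≤ K + 3 → |k'| ≤ 11 → |l'| ≤ K + 3 →
    ∀ p q : ℤ × ℤ, p = gridPt (B * a * 8 ^ J) (a * 4 ^ J) k l →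
      q = gridPt (B * a * 8 ^ J) (a * 4 ^ J) k' l' → p ≤ q → (a : ℝ) ≤ ht (q - p) →
      lastPassage W p q ω ≤
        lam * ht (q - p) - G * (off (q - p) ^ 2 / ht (q - p)) + a * 2 ^ J

/-- Induction on the scale: project the current grid point to the next coarser grid and concatenate.
The bounds `5` and `3` on the distances reproduce themselves, since `5 + 4 · 8 ≤ 5 · 8` and `3 + 2 ·
4 ≤ 3 · 4`. -/
theorem ChainGood.exists_gridPt {W : ℤ × ℤ → Ω → ℝ} {lam G : ℝ} {B a J K : ℕ} {ω : Ω}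
    (hgood : ChainGood W lam G B a J K ω) (hω : ∀ p, 0 ≤ W p ω) (hlam : 0 ≤ lam) (hG : 0 ≤ G)
    (hB : 2 ≤ B) (ha : 1 ≤ a) {u : ℤ × ℤ} (hu : |ht u| ≤ 16 * (B * a * 8 ^ J))
    (hu' : |off u| ≤ K * (a * 4 ^ J)) :
    ∀ i ≤ J, ∃ k l : ℤ, ∃ U : ℤ × ℤ, U = gridPt (B * a * 8 ^ i) (a * 4 ^ i) k l ∧
      |k| ≤ 11 * 8 ^ (J - i) ∧ |l| ≤ (K + 3) * 4 ^ (J - i) ∧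
      2 * (B * a * 8 ^ i : ℝ) ≤ ht (u - U) ∧ ht (u - U) ≤ 5 * (B * a * 8 ^ i) ∧
      0 ≤ off (u - U) ∧ off (u - U) ≤ 3 * (a * 4 ^ i) ∧ U ≤ u - (1, 0) ∧
      lam * ht (u - U) - (4 * lam * B + 4 * G) * (a * 2 ^ i) -
        4 * (a * 2 ^ i) * (3 / 2) ^ (J - i) ≤ halfPassage W U u ω := by
  have hB' : (2 : ℝ) ≤ B := by exact_mod_cast hB
  have ha' : (1 : ℝ) ≤ a := by exact_mod_cast ha
  have box : ∀ i ≤ J, ∀ k l : ℤ, ∀ U : ℤ × ℤ, U = gridPt (B * a * 8 ^ i) (a * 4 ^ i) k l →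
      0 ≤ ht (u - U) → ht (u - U) ≤ 5 * (B * a * 8 ^ i) → 0 ≤ off (u - U) →
      off (u - U) ≤ 3 * (a * 4 ^ i) →
      |k| ≤ 11 * 8 ^ (J - i) ∧ |l| ≤ (K + 3) * 4 ^ (J - i) := by
    intro i hi k l U hU h1 h2 h3 h4
    obtain ⟨j, rfl⟩ := Nat.exists_eq_add_of_le hi
    rw [Nat.add_sub_cancel_left]
    have p8 : (1 : ℝ) ≤ 8 ^ j := one_le_pow₀ (by norm_num)
    have p4 : (1 : ℝ) ≤ 4 ^ j := one_le_pow₀ (by norm_num)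
    set h : ℝ := B * a * 8 ^ i with hh
    set w : ℝ := a * 4 ^ i with hw
    have hh0 : 0 < h := by positivity
    have hw0 : 0 < w := by positivity
    rw [ht_sub, hU, ht_gridPt] at h1 h2
    rw [off_sub, hU, off_gridPt] at h3 h4
    push_cast at h1 h2 h3 h4
    rw [← hh] at h1 h2
    rw [← hw] at h3 h4
    have e1 : 16 * ((B : ℝ) * a * 8 ^ (i + j)) = 16 * 8 ^ j * h := by rw [hh]; ring
    have e2 : (K : ℝ) * (a * 4 ^ (i + j)) = K * 4 ^ j * w := by rw [hw]; ring
    rw [e1] at hu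
    rw [e2] at hu'
    rw [abs_le] at hu hu'
    have b1 : 5 * h ≤ 5 * 8 ^ j * h := by
      have := mul_le_mul_of_nonneg_right p8 hh0.le
      linarith
    have b2 : 3 * w ≤ 3 * 4 ^ j * w := by
      have := mul_le_mul_of_nonneg_right p4 hw0.le
      linarith
    have c1 : |(k : ℝ)| ≤ 11 * 8 ^ j := by
      refine le_of_mul_le_mul_right ?_ hh0
      rw [← abs_of_pos hh0, ← abs_mul, abs_of_pos hh0, abs_le]
      constructor <;> linarith
    have c2 : |(l : ℝ)| ≤ (K + 3) * 4 ^ j := by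
      refine le_of_mul_le_mul_right ?_ hw0
      have : 0 ≤ (K : ℝ) * 4 ^ j * w := by positivity
      rw [← abs_of_pos hw0, ← abs_mul, abs_of_pos hw0, abs_le]
      constructor <;> linarith
    exact ⟨by exact_mod_cast c1, by exact_mod_cast c2⟩
  have hint8 : ∀ i, (0 : ℤ) < B * a * 8 ^ i := fun i => by
    have : (0 : ℤ) < B := by omega
    have : (0 : ℤ) < a := by omega
    positivity
  have hint4 : ∀ i, (0 : ℤ) < a * 4 ^ i := fun i => by
    have : (0 : ℤ) < a := by omega
    positivity
  have hwh : ∀ i : ℕ, 2 * ((a : ℝ) * 4 ^ i) ≤ B * a * 8 ^ i := by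
    intro i
    have : (4 : ℝ) ^ i ≤ 8 ^ i := pow_le_pow_left₀ (by norm_num) (by norm_num) i
    calc 2 * ((a : ℝ) * 4 ^ i) = 2 * a * 4 ^ i := by ring
      _ ≤ B * a * 8 ^ i := by gcongr
  have hh1 : ∀ i : ℕ, 1 ≤ (B : ℝ) * a * 8 ^ i := by
    intro i
    have h4 : (1 : ℝ) ≤ 4 ^ i := one_le_pow₀ (by norm_num)
    have : 1 * 1 ≤ (a : ℝ) * 4 ^ i := mul_le_mul ha' h4 zero_le_one (by linarith)
    linarith [hwh i]
  intro i
  induction i with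
  | zero =>
    intro _
    obtain ⟨g1, g2, g3, g4⟩ := gridProj_bounds (hint8 0) (hint4 0) u
    set p := gridProj (B * a * 8 ^ 0) (a * 4 ^ 0) u with hp
    simp only [Int.cast_mul, Int.cast_pow, Int.cast_natCast, Int.cast_ofNat] at g1 g2 g4
    have w0 := hwh 0
    have w1 := hh1 0
    have hb := box 0 (Nat.zero_le _) _ _ p rfl (by linarith) (by linarith) g3
      (by linarith [show (0 : ℝ) ≤ a * 4 ^ 0 by positivity])
    refine ⟨_, _, p, rfl, hb.1, hb.2, g1, by linarith, g3,
      by linarith [show (0 : ℝ) ≤ a * 4 ^ 0 by positivity],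
      le_sub_of_ht_off g3 (by linarith) (by linarith), ?_⟩
    -- At the finest scale nonnegativity suffices: the lost drift is at most `4 lam B a`.
    refine le_trans ?_ (lastPassage_nonneg hω)
    have q0 : lam * ht (u - p) ≤ lam * (4 * (B * a * 8 ^ 0)) :=
      mul_le_mul_of_nonneg_left g2 hlam
    have q1 : 0 ≤ 4 * G * ((a : ℝ) * 2 ^ 0) := by positivity
    have q2 : 0 ≤ 4 * ((a : ℝ) * 2 ^ 0) * (3 / 2) ^ (J - 0) := by positivity
    simp only [pow_zero, mul_one] at q0 q1 q2 ⊢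
    linarith
  | succ i ih =>
    intro hi
    obtain ⟨k, l, q, hq, hk, hl, a1, a2, a3, a4, a5, a6⟩ := ih (by omega)
    have hstep := hgood i (by omega) k l hk hl q _ hq rfl
    obtain ⟨g1, g2, g3, g4⟩ := gridProj_bounds (hint8 (i + 1)) (hint4 (i + 1)) q
    set p := gridProj (B * a * 8 ^ (i + 1)) (a * 4 ^ (i + 1)) q with hp
    push_cast at g1 g2 g3 g4
    have w0 := hwh (i + 1)
    have w1 := hh1 (i + 1)
    have e8 : (B : ℝ) * a * 8 ^ (i + 1) = 8 * (B * a * 8 ^ i) := by ring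
    have e4 : (a : ℝ) * 4 ^ (i + 1) = 4 * (a * 4 ^ i) := by ring
    have e2 : (a : ℝ) * 2 ^ (i + 1) = 2 * (a * 2 ^ i) := by ring
    have x1 := hh1 i
    have x2 : 0 < (a : ℝ) * 4 ^ i := by positivity
    have x3 : 0 < (a : ℝ) * 2 ^ i := by positivity
    have eht : ht (u - p) = ht (u - q) + ht (q - p) := by simp only [ht_sub]; ring
    have eoff : off (u - p) = off (u - q) + off (q - p) := by simp only [off_sub]; ring
    have r1 : ht (u - p) ≤ 5 * (B * a * 8 ^ (i + 1)) := by linarith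
    have r2 : off (u - p) ≤ 3 * (a * 4 ^ (i + 1)) := by linarith
    have r3 : 0 ≤ off (u - p) := by linarith
    have r4 : 2 * ((B : ℝ) * a * 8 ^ (i + 1)) ≤ ht (u - p) := by linarith
    have hb := box (i + 1) hi _ _ p rfl (by linarith) r1 r3 r2
    refine ⟨_, _, p, rfl, hb.1, hb.2, r4, r1, r3, r2, ?_, ?_⟩
    · exact le_sub_of_ht_off r3 (by linarith) (by linarith)
    · have hpq : p ≤ q - (1, 0) := le_sub_of_ht_off g3 (by linarith) (by linarith)
      have hsup := halfPassage_superadditive (W := W) (ω := ω) hpq a5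
      obtain ⟨j, hj⟩ := Nat.exists_eq_add_of_le hi
      rw [show J - i = j + 1 by omega] at a6
      rw [show J - 1 - i = j by omega] at hstep
      rw [show J - (i + 1) = j by omega]
      have hpar : off (q - p) ^ 2 / ht (q - p) ≤ 2 * (a * 2 ^ (i + 1)) := by
        have p2 : (4 : ℝ) ^ (i + 1) = 2 ^ (i + 1) * 2 ^ (i + 1) := by
          rw [← mul_pow]; norm_num
        have p3 : (8 : ℝ) ^ (i + 1) = 2 ^ (i + 1) * 2 ^ (i + 1) * 2 ^ (i + 1) := by
          rw [← mul_pow, ← mul_pow]; norm_num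
        set z : ℝ := 2 ^ (i + 1) with hz
        have hz0 : 0 < z := by positivity
        rw [div_le_iff₀ (by linarith)]
        calc off (q - p) ^ 2 ≤ (2 * (a * 4 ^ (i + 1))) ^ 2 := pow_le_pow_left₀ g3 g4 2
          _ = 1 * (2 * (a * z)) * (2 * (a * (z * z * z))) := by rw [p2]; ring
          _ ≤ B * (2 * (a * z)) * (2 * (a * (z * z * z))) := by gcongr; linarith
          _ = 2 * (a * z) * (2 * (B * a * 8 ^ (i + 1))) := by rw [p3]; ring
          _ ≤ 2 * (a * z) * ht (q - p) := by gcongr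
      have hGp := mul_le_mul_of_nonneg_left hpar hG
      -- The error closes up exactly: in units of `a 2^i (3/2)^j`, the previous `6` plus the new `2`
      -- make `8`.
      have s1 : (a : ℝ) * (3 / 2) ^ j * 2 ^ (i + 1) = 2 * ((a * 2 ^ i) * (3 / 2) ^ j) := by ring
      have s2 : 4 * ((a : ℝ) * 2 ^ i) * (3 / 2) ^ (j + 1) = 6 * ((a * 2 ^ i) * (3 / 2) ^ j) := by
        ring
      have s3 : 4 * (2 * ((a : ℝ) * 2 ^ i)) * (3 / 2) ^ j = 8 * ((a * 2 ^ i) * (3 / 2) ^ j) := by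
        ring
      have s4 : 0 ≤ lam * B * ((a : ℝ) * 2 ^ i) := by positivity
      rw [eht, mul_add, e2, s3]
      rw [s1] at hstep
      rw [s2] at a6
      rw [e2] at hGp
      linarith

end Chain

/-! ### Probability of the good events. -/

section Probability

variable {Ω : Type*} [MeasurableSpace Ω] {P : Measure Ω} [IsProbabilityMeasure P]
  {W : ℤ × ℤ → Ω → ℝ} {lam G ρ : ℝ}

/-- By Bernoulli `(3/2)^j ≥ 1 + j/2`, so for large `a` the exponential gains a factor `64^(-j)`,
which beats `32^j`. -/
theorem sum_exp_le {c : ℝ} {a : ℝ} (hc : 0 < c) (ha : 2 * Real.log 64 / c ≤ a) (J : ℕ) :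
    ∑ j ∈ Finset.range J, (32 : ℝ) ^ j * Real.exp (-c * (a * (3 / 2) ^ j)) ≤
      2 * Real.exp (-c * a) := by
  have ha0 : 0 ≤ a := le_trans (by have := Real.log_nonneg (show (1 : ℝ) ≤ 64 by norm_num); positivity) ha
  have h64 : Real.exp (-c * a / 2) ≤ 1 / 64 := by
    rw [div_le_iff₀ hc] at ha
    calc Real.exp (-c * a / 2) ≤ Real.exp (-Real.log 64) := Real.exp_le_exp.2 (by linarith)
      _ = 1 / 64 := by rw [Real.exp_neg, Real.exp_log (by norm_num)]; norm_num
  have hterm : ∀ j : ℕ, (32 : ℝ) ^ j * Real.exp (-c * (a * (3 / 2) ^ j)) ≤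
      Real.exp (-c * a) * (1 / 2) ^ j := by
    intro j
    have hb : 1 + (j : ℝ) * (1 / 2) ≤ (3 / 2 : ℝ) ^ j := by
      have := one_add_mul_le_pow (show (-2 : ℝ) ≤ 1 / 2 by norm_num) j
      norm_num at this ⊢
      linarith
    have h1 : Real.exp (-c * (a * (3 / 2) ^ j)) ≤ Real.exp (-c * a) * Real.exp (-c * a / 2) ^ j := by
      rw [← Real.exp_nat_mul, ← Real.exp_add, Real.exp_le_exp]
      have := mul_le_mul_of_nonneg_left hb (show 0 ≤ c * a by positivity)
      linarith
    calc (32 : ℝ) ^ j * Real.exp (-c * (a * (3 / 2) ^ j))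
        ≤ 32 ^ j * (Real.exp (-c * a) * (1 / 64) ^ j) := by
          refine mul_le_mul_of_nonneg_left (h1.trans ?_) (by positivity)
          gcongr
      _ = Real.exp (-c * a) * (32 * (1 / 64)) ^ j := by rw [mul_pow]; ring
      _ = _ := by norm_num
  refine (Finset.sum_le_sum fun j _ => hterm j).trans ?_
  rw [← Finset.mul_sum, mul_comm]
  exact mul_le_mul_of_nonneg_right (sum_geometric_two_le J) (Real.exp_pos _).le

theorem card_Icc_neg_le (n : ℤ) (hn : 1 ≤ n) :
    ((Finset.Icc (-n) n).card : ℝ) ≤ 3 * n := by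
  rw [Int.card_Icc]
  have : ((n + 1 - -n).toNat : ℝ) = ((n + 1 - -n : ℤ) : ℝ) := by
    rw [← Int.cast_natCast, Int.toNat_of_nonneg (by omega)]
  rw [this]
  norm_cast
  omega

theorem LowerTail.chainGood (hW : LowerTail P W lam G ρ) {B : ℕ} (hB : 2 ≤ B)
    (hρB : 1 ≤ ρ * B) (K : ℕ) :
    ∃ c a₀ C : ℝ, 0 < c ∧ 0 < a₀ ∧ 0 < C ∧ ∀ a J : ℕ, a₀ ≤ a →
      P.real {ω | ¬ ChainGood W lam G B a J K ω} ≤ C * Real.exp (-c * a) := by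
  have hB' : (2 : ℝ) ≤ B := by exact_mod_cast hB
  obtain ⟨c, a₀, hc, ha0, h⟩ := hW (4 * B) (by positivity)
  refine ⟨c, a₀ + 2 * Real.log 64 / c, 33 * (3 * (K + 3)) * 32 * 2, hc,
    by have := Real.log_nonneg (show (1 : ℝ) ≤ 64 by norm_num); positivity, by positivity,
    fun a J ha => ?_⟩
  have hlog : 0 ≤ 2 * Real.log 64 / c := by
    have := Real.log_nonneg (show (1 : ℝ) ≤ 64 by norm_num)
    positivity
  have ha' : (0 : ℝ) < a := by linarith
  have hapos : 0 < a := by exact_mod_cast ha'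
  let q : ℕ → ℤ × ℤ → ℤ × ℤ := fun i kl => gridPt (B * a * 8 ^ i) (a * 4 ^ i) kl.1 kl.2
  let p : ℕ → ℤ × ℤ → ℤ × ℤ := fun i kl => gridProj (B * a * 8 ^ (i + 1)) (a * 4 ^ (i + 1)) (q i kl)
  let bad : ℕ → ℤ × ℤ → Set Ω := fun i kl => {ω | halfPassage W (p i kl) (q i kl) ω <
    lam * ht (q i kl - p i kl) - G * (off (q i kl - p i kl) ^ 2 / ht (q i kl - p i kl)) -
        a * (3 / 2) ^ (J - 1 - i) * 2 ^ (i + 1)}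
  let idx : ℕ → Finset (ℤ × ℤ) := fun i =>
    Finset.Icc (-(11 * 8 ^ (J - i)) : ℤ) (11 * 8 ^ (J - i)) ×ˢ
      Finset.Icc (-((K + 3) * 4 ^ (J - i)) : ℤ) ((K + 3) * 4 ^ (J - i))
  have hsub : {ω | ¬ ChainGood W lam G B a J K ω} ⊆
      ⋃ i ∈ Finset.range J, ⋃ kl ∈ idx i, bad i kl := by
    intro ω hω
    simp only [Set.mem_ofPred_eq, ChainGood] at hω
    push Not at hω
    obtain ⟨i, hi, k, l, hk, hl, _, _, rfl, rfl, hlt⟩ := hω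
    simp only [Set.mem_iUnion]
    refine ⟨i, Finset.mem_range.2 hi, (k, l), ?_, hlt⟩
    simp only [idx, Finset.mem_product, Finset.mem_Icc]
    exact ⟨abs_le.1 hk, abs_le.1 hl⟩
  have hbad : ∀ i kl, P.real (bad i kl) ≤ Real.exp (-c * (a * (3 / 2) ^ (J - 1 - i))) := by
    intro i kl
    have hint8 : (0 : ℤ) < B * a * 8 ^ (i + 1) := by
      have : (0 : ℤ) < B := by omega
      have : (0 : ℤ) < a := by omega
      positivity
    have hint4 : (0 : ℤ) < a * 4 ^ (i + 1) := by
      have : (0 : ℤ) < a := by omega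
      positivity
    obtain ⟨g1, g2, g3, g4⟩ := gridProj_bounds hint8 hint4 (q i kl)
    change 2 * _ ≤ ht (q i kl - p i kl) at g1
    change ht (q i kl - p i kl) ≤ _ at g2
    change 0 ≤ off (q i kl - p i kl) at g3
    change off (q i kl - p i kl) ≤ _ at g4
    push_cast at g1 g2 g3 g4
    have p32 : (1 : ℝ) ≤ (3 / 2) ^ (J - 1 - i) := one_le_pow₀ (by norm_num)
    have p8 : (1 : ℝ) ≤ 8 ^ (i + 1) := one_le_pow₀ (by norm_num)
    have haa : (a : ℝ) ≤ a * (3 / 2) ^ (J - 1 - i) := le_mul_of_one_le_right ha'.le p32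
    refine h _ _ (by linarith) (by positivity) _ _ ?_ ?_ ?_
    · have : (1 : ℝ) * a * 1 ≤ B * a * 8 ^ (i + 1) := by gcongr; linarith
      linarith
    · refine g2.trans ?_
      have : ((2 : ℝ) ^ (i + 1)) ^ 3 = 8 ^ (i + 1) := by
        rw [← pow_mul, mul_comm, pow_mul]; norm_num
      rw [this, mul_assoc (B : ℝ), ← mul_assoc 4]
      gcongr
    · rw [abs_of_nonneg g3]
      have hρ0 : 0 ≤ ρ := (pos_of_mul_pos_left (by linarith : 0 < ρ * B) (by positivity)).le
      have : (4 : ℝ) ^ (i + 1) ≤ 8 ^ (i + 1) := pow_le_pow_left₀ (by norm_num) (by norm_num) _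
      calc off (q i kl - p i kl) ≤ 1 * (2 * (a * 4 ^ (i + 1))) := by linarith
        _ ≤ (ρ * B) * (2 * (a * 8 ^ (i + 1))) := by gcongr
        _ = ρ * (2 * (B * a * 8 ^ (i + 1))) := by ring
        _ ≤ _ := by gcongr
  have hcard : ∀ i < J, ((idx i).card : ℝ) ≤ 33 * (3 * (K + 3)) * 32 * 32 ^ (J - 1 - i) := by
    intro i hi
    obtain ⟨j, hj⟩ : ∃ j, J - i = j + 1 := ⟨J - i - 1, by omega⟩
    simp only [idx, Finset.card_product]
    rw [hj, show J - 1 - i = j by omega]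
    push_cast
    have p8 : (1 : ℤ) ≤ 8 ^ (j + 1) := one_le_pow₀ (by norm_num)
    have p4 : (1 : ℤ) ≤ 4 ^ (j + 1) := one_le_pow₀ (by norm_num)
    have h1 := card_Icc_neg_le (11 * 8 ^ (j + 1)) (by omega)
    have h2 := card_Icc_neg_le ((K + 3) * 4 ^ (j + 1)) (by nlinarith)
    push_cast at h1 h2
    calc _ ≤ (3 * (11 * (8 : ℝ) ^ (j + 1))) * (3 * ((K + 3) * 4 ^ (j + 1))) := by gcongr
      _ = 33 * (3 * (K + 3)) * (8 ^ (j + 1) * 4 ^ (j + 1)) := by ring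
      _ = 33 * (3 * (K + 3)) * 32 ^ (j + 1) := by rw [← mul_pow]; norm_num
      _ = _ := by ring
  calc P.real {ω | ¬ ChainGood W lam G B a J K ω}
      ≤ P.real (⋃ i ∈ Finset.range J, ⋃ kl ∈ idx i, bad i kl) := measureReal_mono hsub (measure_ne_top _ _)
    _ ≤ ∑ i ∈ Finset.range J, P.real (⋃ kl ∈ idx i, bad i kl) := measureReal_biUnion_finset_le _ _
    _ ≤ ∑ i ∈ Finset.range J, (33 * (3 * (K + 3)) * 32) *
          ((32 : ℝ) ^ (J - 1 - i) * Real.exp (-c * (a * (3 / 2) ^ (J - 1 - i)))) := by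
        refine Finset.sum_le_sum fun i hi => ?_
        refine (measureReal_biUnion_finset_le _ _).trans ?_
        refine (Finset.sum_le_sum fun kl _ => hbad i kl).trans ?_
        rw [Finset.sum_const, nsmul_eq_mul]
        exact (mul_le_mul_of_nonneg_right (hcard i (Finset.mem_range.1 hi))
          (Real.exp_pos _).le).trans_eq (mul_assoc _ _ _)
    _ = (33 * (3 * (K + 3)) * 32) *
          ∑ j ∈ Finset.range J, (32 : ℝ) ^ j * Real.exp (-c * (a * (3 / 2) ^ j)) := by
        rw [← Finset.mul_sum]
        congr 1
        exact Finset.sum_range_reflect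
          (fun j => (32 : ℝ) ^ j * Real.exp (-c * (a * (3 / 2) ^ j))) J
    _ ≤ (33 * (3 * (K + 3)) * 32) * (2 * Real.exp (-c * a)) := by
        gcongr
        exact sum_exp_le hc (by linarith) J
    _ = _ := by ring

/-- The number of pairs depends only on `K`, so a plain union bound works. The factor `44` is twice
the largest difference of the longitudinal indices. -/
theorem UpperTail.coarseGood (hW : UpperTail P W lam G) {B : ℕ} (hB : 2 ≤ B) (K : ℕ) :
    ∃ c a₀ C : ℝ, 0 < c ∧ 0 < a₀ ∧ 0 < C ∧ ∀ a J : ℕ, a₀ ≤ a →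
      P.real {ω | ¬ CoarseGood W lam G B a J K ω} ≤ C * Real.exp (-c * a) := by
  have hB' : (2 : ℝ) ≤ B := by exact_mod_cast hB
  obtain ⟨c, a₀, hc, ha0, h⟩ := hW (44 * B) (by positivity)
  let idx : Finset (ℤ × ℤ) :=
    Finset.Icc (-11) 11 ×ˢ Finset.Icc (-((K : ℤ) + 3)) ((K : ℤ) + 3)
  refine ⟨c, a₀, (idx ×ˢ idx).card * 2 + 1, hc, ha0, by positivity, fun a J ha => ?_⟩
  let pt : ℤ × ℤ → ℤ × ℤ := fun kl => gridPt (B * a * 8 ^ J) (a * 4 ^ J) kl.1 kl.2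
  let bad : (ℤ × ℤ) × (ℤ × ℤ) → Set Ω := fun x => {ω | pt x.1 ≤ pt x.2 ∧
    (a : ℝ) ≤ ht (pt x.2 - pt x.1) ∧ lam * ht (pt x.2 - pt x.1) -
      G * (off (pt x.2 - pt x.1) ^ 2 / ht (pt x.2 - pt x.1)) + a * 2 ^ J <
        lastPassage W (pt x.1) (pt x.2) ω}
  have hsub : {ω | ¬ CoarseGood W lam G B a J K ω} ⊆ ⋃ x ∈ idx ×ˢ idx, bad x := by
    intro ω hω
    simp only [Set.mem_ofPred_eq, CoarseGood] at hω
    push Not at hω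
    obtain ⟨k, l, k', l', hk, hl, hk', hl', _, _, rfl, rfl, hle, hht, hlt⟩ := hω
    simp only [Set.mem_iUnion]
    refine ⟨((k, l), (k', l')), ?_, hle, hht, hlt⟩
    simp only [idx, Finset.mem_product, Finset.mem_Icc]
    exact ⟨⟨abs_le.1 hk, abs_le.1 hl⟩, ⟨abs_le.1 hk', abs_le.1 hl'⟩⟩
  have hbad : ∀ x ∈ idx ×ˢ idx, P.real (bad x) ≤ 2 * Real.exp (-c * a) := by
    intro x hx
    by_cases hle : pt x.1 ≤ pt x.2 ∧ (a : ℝ) ≤ ht (pt x.2 - pt x.1)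
    · refine (measureReal_mono fun ω hω => hω.2.2).trans
        (h a (2 ^ J) ha (one_le_pow₀ (by norm_num)) _ _ hle.1 (ha.trans hle.2) ?_)
      simp only [idx, Finset.mem_product, Finset.mem_Icc] at hx
      simp only [pt, ht_sub, ht_gridPt]
      have h1 : (-11 : ℝ) ≤ x.1.1 := by exact_mod_cast hx.1.1.1
      have h2 : (x.2.1 : ℝ) ≤ 11 := by exact_mod_cast hx.2.1.2
      have e : ((2 : ℝ) ^ J) ^ 3 = 8 ^ J := by rw [← pow_mul, mul_comm, pow_mul]; norm_num
      rw [e]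
      push_cast
      calc 2 * ((x.2.1 : ℝ) * (B * a * 8 ^ J)) - 2 * (x.1.1 * (B * a * 8 ^ J))
          = (2 * (x.2.1 - x.1.1)) * (B * (a * 8 ^ J)) := by ring
        _ ≤ 44 * (B * (a * 8 ^ J)) := by gcongr; linarith
        _ = _ := by ring
    · have : bad x = ∅ := by
        ext ω
        simp only [bad, Set.mem_ofPred_eq, Set.mem_empty_iff_false, iff_false]
        exact fun hω => hle ⟨hω.1, hω.2.1⟩
      rw [this, measureReal_empty]
      positivity
  calc P.real {ω | ¬ CoarseGood W lam G B a J K ω}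
      ≤ P.real (⋃ x ∈ idx ×ˢ idx, bad x) := measureReal_mono hsub (measure_ne_top _ _)
    _ ≤ ∑ x ∈ idx ×ˢ idx, P.real (bad x) := measureReal_biUnion_finset_le _ _
    _ ≤ ∑ x ∈ idx ×ˢ idx, 2 * Real.exp (-c * a) := Finset.sum_le_sum hbad
    _ = (idx ×ˢ idx).card * 2 * Real.exp (-c * a) := by
        rw [Finset.sum_const, nsmul_eq_mul, mul_assoc]
    _ ≤ _ := by
        gcongr
        linarith

end Probability

/-! ### Deterministic bound on the good event. -/

section Deterministic

variable {Ω : Type*} {W : ℤ × ℤ → Ω → ℝ} {ω : Ω}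

theorem abs_off_sub_le {u v : ℤ × ℤ} (h : u ≤ v) : |off v - off u| ≤ ht v - ht u := by
  have h1 : (u.1 : ℝ) ≤ v.1 := by exact_mod_cast h.1
  have h2 : (u.2 : ℝ) ≤ v.2 := by exact_mod_cast h.2
  simp only [off, ht]
  rw [abs_le]
  constructor <;> linarith

theorem Step.abs_off_le {p q : ℤ × ℤ} (h : Step p q) : |off q| ≤ |off p| + 1 := by
  have h1 := abs_off_sub_le h.lt.le
  have h2 : ht q - ht p = 1 := by
    rcases h with rfl | rfl <;> simp [ht]
  have := abs_sub_abs_le_abs_sub (off q) (off p)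
  linarith

theorem exists_first_crossing {γ : List (ℤ × ℤ)} (hγ : γ.IsChain Step) {x : ℝ}
    (h0 : ∀ u ∈ γ.head?, |off u| ≤ x) (h : ∃ p ∈ γ, x < |off p|) :
    ∃ p ∈ γ, x < |off p| ∧ |off p| ≤ x + 1 := by
  induction γ with
  | nil => simp at h
  | cons a l ih =>
    have ha : |off a| ≤ x := h0 a (by simp)
    obtain ⟨p, hp, hpx⟩ := h
    have hpl : p ∈ l := by
      rcases List.mem_cons.1 hp with rfl | hp
      · exact absurd hpx (not_lt.2 ha)
      · exact hp
    cases l with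
    | nil => simp at hpl
    | cons b l =>
      rw [List.isChain_cons_cons] at hγ
      by_cases hb : |off b| ≤ x
      · obtain ⟨p, hp, h⟩ := ih hγ.2 (by simpa using hb) ⟨p, hpl, hpx⟩
        exact ⟨p, List.mem_cons_of_mem _ hp, h⟩
      · exact ⟨b, by simp, not_le.1 hb, by linarith [hγ.1.abs_off_le]⟩

theorem exists_lt_of_lt_transFluct {γ : List (ℤ × ℤ)} {x : ℝ} (hx : 0 ≤ x)
    (h : x < transFluct γ) : ∃ p ∈ γ, x * Real.sqrt 2 < |off p| := by
  have hne : {d : ℝ | ∃ p ∈ γ, d = |(p.1 : ℝ) - (p.2 : ℝ)| / Real.sqrt 2}.Nonempty := by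
    rw [Set.nonempty_iff_ne_empty]
    intro he
    rw [transFluct, he, Real.sSup_empty] at h
    linarith
  obtain ⟨_, ⟨p, hp, rfl⟩, hlt⟩ := exists_lt_of_lt_csSup hne h
  exact ⟨p, hp, by rwa [lt_div_iff₀ (by positivity)] at hlt⟩

/-- On the good event a path which makes a large transversal excursion has a small weight. -/
theorem weight_le_of_good {lam G₁ G₂ : ℝ} {B a J K : ℕ} (hω : ∀ p, 0 ≤ W p ω)
    (hdown : ChainGood W lam G₁ B a J K ω) (hup : ChainGood (fun p => W (-p)) lam G₁ B a J K ω)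
    (hcoarse : CoarseGood W lam G₂ B a J K ω) (hlam : 0 ≤ lam) (hG₁ : 0 ≤ G₁) (hG₂ : 0 ≤ G₂)
    (hB : 2 ≤ B) (ha : 1 ≤ a) {u v p : ℤ × ℤ} {γ : List (ℤ × ℤ)} (hγ : IsPath u v γ) (hp : p ∈ γ)
    (hu0 : ht u = 0) (hv : ht v ≤ 16 * (B * a * 8 ^ J)) (hu : |off u| ≤ K * (a * 4 ^ J))
    (hv' : |off v| ≤ K * (a * 4 ^ J)) (hp' : |off p| ≤ K * (a * 4 ^ J)) {D : ℝ} (hD : 0 ≤ D)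
    (hDp : D + 6 * (a * 4 ^ J) ≤ |off p - off u|) :
    weight W γ ω ≤ lam * ht v - G₂ * (D ^ 2 / (ht v + 10 * (B * a * 8 ^ J))) +
      (2 + 4 * (4 * lam * B + 4 * G₁ + 4)) * (a * 2 ^ J) := by
  have hup_le := hγ.le_mem hp
  have hpv_le := hγ.mem_le hp
  have hhu : 0 ≤ ht p := by
    have := abs_off_sub_le hup_le
    linarith [abs_nonneg (off p - off u)]
  have hhv : ht p ≤ ht v := by
    have := abs_off_sub_le hpv_le
    linarith [abs_nonneg (off v - off p)]
  have hB' : (2 : ℝ) ≤ B := by exact_mod_cast hB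
  have ha' : (1 : ℝ) ≤ a := by exact_mod_cast ha
  have hh0 : 0 < (B : ℝ) * a * 8 ^ J := by positivity
  have hah : (a : ℝ) ≤ B * a * 8 ^ J := by
    have p8 : (1 : ℝ) ≤ 8 ^ J := one_le_pow₀ (by norm_num)
    calc (a : ℝ) = 1 * a * 1 := by ring
      _ ≤ B * a * 8 ^ J := by gcongr; linarith
  have hneg : ∀ ω, (∀ p, 0 ≤ W p ω) → ∀ p, 0 ≤ (fun p => W (-p)) p ω := fun ω h p => h (-p)
  have down : ∀ x : ℤ × ℤ, 0 ≤ ht x → ht x ≤ ht v → |off x| ≤ K * (a * 4 ^ J) → _ :=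
    fun x h1 h2 h3 => hdown.exists_gridPt hω hlam hG₁ hB ha (u := x)
      (by rw [abs_le]; constructor <;> linarith) h3 J le_rfl
  have up : ∀ x : ℤ × ℤ, 0 ≤ ht x → ht x ≤ ht v → |off x| ≤ K * (a * 4 ^ J) → _ :=
    fun x h1 h2 h3 => hup.exists_gridPt (hneg ω hω) hlam hG₁ hB ha (u := -x)
      (by rw [ht_neg, abs_le]; constructor <;> linarith) (by rwa [off_neg, abs_neg]) J le_rfl
  -- Extend from `x` and `y` to coarse grid points `U` and `-V`. The drifts of the extensions
  -- cancel, leaving one coarse deviation and two chaining errors; rounding changes the transversal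
  -- displacement by at most three meshes at each end.
  have key : ∀ x y : ℤ × ℤ, x ≤ y → 0 ≤ ht x → ht x ≤ ht y → ht y ≤ ht v →
      |off x| ≤ K * (a * 4 ^ J) → |off y| ≤ K * (a * 4 ^ J) →
      ∃ H D' : ℝ, H ≤ ht y - ht x + 10 * (B * a * 8 ^ J) ∧ 0 < H ∧
        |off y - off x| ≤ |D'| + 6 * (a * 4 ^ J) ∧
        lastPassage W x y ω ≤ lam * (ht y - ht x) - G₂ * (D' ^ 2 / H) +
          (1 + 2 * (4 * lam * B + 4 * G₁ + 4)) * (a * 2 ^ J) := by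
    intro x y hxy hx0 hhxy hyv hx hy
    obtain ⟨k, l, U, hU, hk, hl, a1, a2, a3, a4, a5, a6⟩ := down x hx0 (hhxy.trans hyv) hx
    obtain ⟨k', l', V, hV, hk', hl', b1, b2, b3, b4, b5, b6⟩ := up y (hx0.trans hhxy) hyv hy
    simp only [Nat.sub_self, pow_zero, mul_one] at hk hl hk' hl' a6 b6
    have hyV : y + (1, 0) ≤ -V := by
      rw [le_neg]
      refine b5.trans_eq ?_
      abel
    have hyV' : y ≤ -V := le_trans (by simp [Prod.le_def]) hyV
    have hUx : U ≤ x := le_of_le_sub a5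
    rw [ht_sub] at a1 a2 a6 b1 b2 b6
    rw [off_sub] at a3 a4 b3 b4
    rw [ht_neg] at b1 b2 b6
    rw [off_neg] at b3 b4
    have hc := hcoarse k l (-k') (-l') hk hl (by rwa [abs_neg]) (by rwa [abs_neg]) U (-V) hU
      (by rw [hV, neg_gridPt]) (hUx.trans (hxy.trans hyV')) (by rw [ht_sub, ht_neg]; linarith)
    have s1 := halfPassage_add_lastPassage_le (W := W) (ω := ω) a5 hxy
    have s2 := lastPassage_add_halfPassage_reflect_le (W := W) (ω := ω) (hUx.trans hxy) hyV
    rw [neg_neg] at s2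
    rw [ht_sub, off_sub, ht_neg, off_neg] at hc
    refine ⟨-ht V - ht U, -off V - off U, by linarith, by linarith, ?_, by linarith⟩
    have e : off y - off x = (-off V - off U) - (-off y - off V + (off x - off U)) := by ring
    rw [e]
    refine (abs_sub _ _).trans (add_le_add le_rfl ?_)
    rw [abs_le]
    constructor <;> linarith
  obtain ⟨H, D', h1, h2, h3, h4⟩ := key u p hup_le hu0.ge (by linarith) hhv hu hp'
  obtain ⟨H', D'', -, h2', -, h4'⟩ := key p v hpv_le hhu hhv le_rfl hp' hv'
  have hw := weight_le_add hω hγ hp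
  have hDD : D ^ 2 ≤ D' ^ 2 := by
    rw [← sq_abs D']
    exact pow_le_pow_left₀ hD (by linarith) 2
  have hloss : G₂ * (D ^ 2 / (ht v + 10 * (B * a * 8 ^ J))) ≤ G₂ * (D' ^ 2 / H) := by
    gcongr
    linarith
  have hloss' : 0 ≤ G₂ * (D'' ^ 2 / H') := by positivity
  rw [hu0, sub_zero] at h4
  linarith

end Deterministic

/-! ### Far paths and geodesics. -/

section FarWeight

variable {Ω : Type*}

theorem off_of_mem_antiDiagSegment {h w : ℝ} {p : ℤ × ℤ} (hp : p ∈ antiDiagSegment h w) :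
    ht p = 2 * h ∧ |off p| ≤ 2 * w := by
  obtain ⟨h1, h2⟩ := hp
  refine ⟨h1, ?_⟩
  have : off p = 2 * ((p.1 : ℝ) - h) := by simp only [off]; linarith
  rw [this, abs_mul, abs_two]
  linarith

/-- A path with a large transversal fluctuation has a vertex which is far from the diagonal, but not
much farther than required, and far from the starting point of the path. -/
theorem exists_vertex_of_mem_farPaths {q s t : ℝ} (hq : 1 ≤ q) (hs : 1 ≤ s) (ht0 : 0 ≤ t)
    (hts : t ≤ s) {r : ℝ} (hr : r = q ^ 3) (hrq : r ^ ((2 : ℝ) / 3) = q ^ 2)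
    {γ : List (ℤ × ℤ)} (hγ : γ ∈ farPaths r s t) :
    ∃ u v p : ℤ × ℤ, IsPath u v γ ∧ p ∈ γ ∧ ht u = 0 ∧ ht v = 2 * r ∧
      |off u| ≤ 4 * (s * q ^ 2) ∧ |off v| ≤ 4 * (s * q ^ 2) ∧ |off p| ≤ 4 * (s * q ^ 2) ∧
      4 / 5 * (s * q ^ 2) ≤ |off p - off u| ∧ s ≤ 3 * q := by
  obtain ⟨u, hu, v, hv, hp, hfl⟩ := hγ
  rw [hrq] at hu hv hfl
  obtain ⟨hu1, hu2⟩ := off_of_mem_antiDiagSegment hu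
  obtain ⟨hv1, hv2⟩ := off_of_mem_antiDiagSegment hv
  have hq2 : 1 ≤ q ^ 2 := one_le_pow₀ hq
  have hsq : 1 ≤ s * q ^ 2 := by
    calc (1 : ℝ) = 1 * 1 := by ring
      _ ≤ s * q ^ 2 := by gcongr
  have htq : t * q ^ 2 ≤ s * q ^ 2 := by gcongr
  have htq0 : 0 ≤ t * q ^ 2 := by positivity
  have h2a : (1.4 : ℝ) ≤ Real.sqrt 2 := Real.le_sqrt_of_sq_le (by norm_num)
  have h2b : Real.sqrt 2 ≤ 1.5 := by
    rw [Real.sqrt_le_left (by norm_num)]; norm_num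
  obtain ⟨p₀, hp₀, hlt⟩ := exists_lt_of_lt_transFluct (by positivity) hfl
  have hx1 : 1.4 * (s * q ^ 2 + t * q ^ 2) ≤ (s + t) * q ^ 2 * Real.sqrt 2 := by
    rw [mul_comm _ (Real.sqrt 2), ← add_mul]
    gcongr
  have hx2 : (s + t) * q ^ 2 * Real.sqrt 2 ≤ 1.5 * (s * q ^ 2 + t * q ^ 2) := by
    rw [mul_comm _ (Real.sqrt 2), ← add_mul]
    gcongr
  obtain ⟨p, hpm, hp1, hp2⟩ := exists_first_crossing hp.2.2
    (x := (s + t) * q ^ 2 * Real.sqrt 2) (by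
      intro x hx
      rw [hp.1] at hx
      simp only [Option.mem_def, Option.some.injEq] at hx
      rw [← hx]
      linarith) ⟨p₀, hp₀, hlt⟩
  -- `1.4 (s + t) - 2 t ≥ 0.8 s` because `t ≤ s`.
  have hdist : 4 / 5 * (s * q ^ 2) ≤ |off p - off u| := by
    have := abs_sub_abs_le_abs_sub (off p) (off u)
    linarith
  refine ⟨u, v, p, hp, hpm, by linarith, hv1, by linarith, by linarith, by linarith, hdist, ?_⟩
  have h1 := abs_off_sub_le (hp.le_mem hpm)
  have h2 := abs_off_sub_le (hp.mem_le hpm)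
  have h3 := abs_nonneg (off v - off p)
  have h4 : s * q ^ 2 ≤ (5 / 2 * q) * q ^ 2 := by
    rw [hr] at hv1
    linarith
  have h5 := le_of_mul_le_mul_right h4 (by linarith)
  linarith

theorem le_of_cube_le {x y : ℝ} (hy : 0 ≤ y) (h : x ^ 3 ≤ y ^ 3) : x ≤ y :=
  le_of_pow_le_pow_left₀ (by norm_num) hy h

variable [MeasurableSpace Ω] {P : Measure Ω} [IsProbabilityMeasure P]
  {W : ℤ × ℤ → Ω → ℝ} {lam G₁ G₂ ρ : ℝ}

theorem exists_farWeight_bound (hnn : ∀ᵐ ω ∂P, ∀ p, 0 ≤ W p ω) (hlam : 0 < lam)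
    (hG₁ : 0 < G₁) (hG₂ : 0 < G₂) (hρ : 0 < ρ) (hL : LowerTail P W lam G₁ ρ)
    (hL' : LowerTail P (fun p => W (-p)) lam G₁ ρ) (hU : UpperTail P W lam G₂) :
    ∃ s₀ c c₂ : ℝ, 0 < s₀ ∧ 0 < c ∧ 0 < c₂ ∧
      ∀ r s t : ℝ, 1 < r → s₀ < s → 0 ≤ t → t ≤ s →
        P.real {ω | ((2 * lam * r - c₂ * s ^ 2 * r ^ ((1 : ℝ) / 3) : ℝ) : EReal) <
            farWeight W r s t ω} < Real.exp (-c * s ^ 3) := by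
  obtain ⟨B, hBρ⟩ := exists_nat_gt (max 2 (1 / ρ))
  have hB2 : (2 : ℝ) < B := (le_max_left _ _).trans_lt hBρ
  have hB : 2 ≤ B := by exact_mod_cast hB2.le
  have hρB : 1 ≤ ρ * B := by
    have := ((le_max_right _ _).trans_lt hBρ).le
    rwa [div_le_iff₀ hρ, mul_comm] at this
  set E : ℝ := 4 * lam * B + 4 * G₁ + 4 with hE
  have hE0 : 0 < E := by positivity
  -- `N` transversal meshes of displacement must cost at least `(3 + 4 E) a 2^J`, one unit more than
  -- the total error `(2 + 4 E) a 2^J`.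
  obtain ⟨N, hN⟩ := exists_nat_gt (max 1 ((3 + 4 * E) * (16 + 10 * B) / G₂))
  have hN1 : (1 : ℝ) < N := (le_max_left _ _).trans_lt hN
  have hNG : (3 + 4 * E) * (16 + 10 * B) ≤ G₂ * N ^ 2 := by
    have h1 := ((le_max_right _ _).trans_lt hN).le
    rw [div_le_iff₀ hG₂] at h1
    have h2 : (N : ℝ) ≤ N ^ 2 := le_self_pow₀ hN1.le two_ne_zero
    calc _ ≤ N * G₂ := h1
      _ ≤ N ^ 2 * G₂ := by gcongr
      _ = _ := mul_comm _ _
  -- With mesh at most `ε s r^{2/3}`, the displacement `4/5 s r^{2/3}` contains `N` meshes plus the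
  -- six lost to rounding.
  set ε : ℝ := 4 / 5 / (N + 6) with hε
  have hε0 : 0 < ε := by positivity
  have hεN : 4 / 5 = (N + 6) * ε := by rw [hε]; field_simp
  have hε3 : 3 * ε ≤ 1 := by
    rw [hε, ← mul_div_assoc, div_le_one (by positivity)]
    linarith
  obtain ⟨K, hK⟩ := exists_nat_gt (24 / ε)
  obtain ⟨c₁, a₁, C₁, hc1, ha1, hC1, h1⟩ := hL.chainGood hB hρB K
  obtain ⟨c₂, a₂, C₂, hc2, ha2, hC2, h2⟩ := hL'.chainGood hB hρB K
  obtain ⟨c₃, a₃, C₃, hc3, ha3, hC3, h3⟩ := hU.coarseGood hB K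
  set c : ℝ := min c₁ (min c₂ c₃) with hc
  have hc0 : 0 < c := lt_min hc1 (lt_min hc2 hc3)
  set C : ℝ := C₁ + C₂ + C₃ with hC
  have hC0 : 0 < C := by positivity
  refine ⟨1 + (2 + a₁ + a₂ + a₃ + 1 + 4 * C / c) / ε ^ 3, c * ε ^ 3 / 4, ε ^ 2 / 4, by positivity,
    by positivity, by positivity, fun r s t hr hs ht0 hts => ?_⟩
  set q : ℝ := r ^ ((1 : ℝ) / 3) with hq
  have hr0 : 0 < r := by linarith
  have hq1 : 1 ≤ q := Real.one_le_rpow hr.le (by norm_num)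
  have hq3 : r = q ^ 3 := (cube_rpow_third hr0.le).symm
  have hq2 : r ^ ((2 : ℝ) / 3) = q ^ 2 := by
    rw [hq, ← Real.rpow_natCast, ← Real.rpow_mul hr0.le]; norm_num
  have hs1 : 1 ≤ s := by
    have : 0 ≤ (2 + a₁ + a₂ + a₃ + 1 + 4 * C / c) / ε ^ 3 := by positivity
    linarith
  -- For larger `s` no upright path between the segments can reach so far, so the maximum is `⊥`.
  by_cases hsq : s ≤ 3 * q
  swap
  · have hempty : ∀ ω, farWeight W r s t ω = ⊥ := by
      intro ω
      have : farPaths r s t = ∅ := by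
        rw [Set.eq_empty_iff_forall_notMem]
        intro γ hγ
        obtain ⟨_, _, _, -, -, -, -, -, -, -, -, h⟩ :=
          exists_vertex_of_mem_farPaths hq1 hs1 ht0 hts hq3 hq2 hγ
        exact hsq h
      simp [farWeight, this]
    simp only [hempty, not_lt_bot, Set.ofPred_false, measureReal_empty]
    exact Real.exp_pos _
  set x : ℝ := (ε * s) ^ 3 with hx
  have hx0 : 0 < x := by positivity
  have hxs : 2 + a₁ + a₂ + a₃ + 1 + 4 * C / c ≤ x := by
    have h1 : (2 + a₁ + a₂ + a₃ + 1 + 4 * C / c) / ε ^ 3 ≤ s := by linarith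
    rw [div_le_iff₀ (by positivity)] at h1
    have h2 : s ≤ s ^ 3 := le_self_pow₀ hs1 (by norm_num)
    calc _ ≤ s * ε ^ 3 := h1
      _ ≤ s ^ 3 * ε ^ 3 := by gcongr
      _ = x := by rw [hx]; ring
  have hCc : 0 < 4 * C / c := by positivity
  set a : ℕ := ⌊x⌋₊ with ha
  have hax : (a : ℝ) ≤ x := Nat.floor_le hx0.le
  have hxa : x < a + 1 := Nat.lt_floor_add_one x
  have ha' : (1 : ℝ) ≤ a := by linarith
  have ha1' : 1 ≤ a := by exact_mod_cast ha'
  have hx2a : x ≤ 2 * a := by linarith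
  have hxr : x ≤ r := by
    calc x ≤ (ε * (3 * q)) ^ 3 := by rw [hx]; gcongr
      _ = (3 * ε) ^ 3 * r := by rw [hq3]; ring
      _ ≤ 1 ^ 3 * r := by gcongr
      _ = r := by ring
  -- `J` is chosen with `a 8^J ≤ r < a 8^(J+1)`; this needs `a ≤ r`, hence `s ≤ 3 q` and `3 ε ≤ 1`.
  obtain ⟨J, hJ1, hJ2⟩ := exists_nat_pow_near (x := r / a) (y := 8)
    (by rw [le_div_iff₀ (by linarith)]; linarith) (by norm_num)
  rw [le_div_iff₀ (by linarith)] at hJ1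
  rw [div_lt_iff₀ (by linarith)] at hJ2
  have e2 : (8 : ℝ) ^ J = (2 ^ J) ^ 3 := by rw [← pow_mul, mul_comm, pow_mul]; norm_num
  have e4 : (4 : ℝ) ^ J = (2 ^ J) ^ 2 := by rw [← pow_mul, mul_comm, pow_mul]; norm_num
  set m : ℝ := 2 ^ J with hm
  have hm0 : 0 < m := by positivity
  rw [e2] at hJ1
  rw [pow_succ, e2] at hJ2
  have hr8 : r < 8 * (a * m ^ 3) := by linarith
  have hra : a * m ^ 3 ≤ r := by linarith
  have ha0 : (0 : ℝ) < a := by linarith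
  have f1 : a * m ^ 2 ≤ ε * (s * q ^ 2) := by
    refine le_of_cube_le (by positivity) ?_
    calc (a * m ^ 2) ^ 3 = a * (a * m ^ 3) ^ 2 := by ring
      _ ≤ x * r ^ 2 := by gcongr
      _ = _ := by rw [hx, hq3]; ring
  have f2 : ε * (s * q ^ 2) ≤ 6 * (a * m ^ 2) := by
    refine le_of_cube_le (by positivity) ?_
    calc (ε * (s * q ^ 2)) ^ 3 = x * r ^ 2 := by rw [hx, hq3]; ring
      _ ≤ (2 * a) * (8 * (a * m ^ 3)) ^ 2 := by gcongr
      _ = 128 * (a * m ^ 2) ^ 3 := by ring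
      _ ≤ 216 * (a * m ^ 2) ^ 3 := by gcongr; norm_num
      _ = _ := by ring
  have f3 : ε ^ 2 * s ^ 2 * q ≤ 4 * (a * m) := by
    refine le_of_cube_le (by positivity) ?_
    calc (ε ^ 2 * s ^ 2 * q) ^ 3 = x ^ 2 * r := by rw [hx, hq3]; ring
      _ ≤ (2 * a) ^ 2 * (8 * (a * m ^ 3)) := by gcongr
      _ = 32 * (a * m) ^ 3 := by ring
      _ ≤ 64 * (a * m) ^ 3 := by gcongr; norm_num
      _ = _ := by ring
  have f4 : 4 * (s * q ^ 2) ≤ K * (a * 4 ^ J) := by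
    rw [e4]
    rw [div_lt_iff₀ hε0] at hK
    refine le_of_mul_le_mul_right ?_ hε0
    calc 4 * (s * q ^ 2) * ε ≤ 24 * (a * m ^ 2) := by linarith
      _ ≤ K * ε * (a * m ^ 2) := by gcongr
      _ = _ := by ring
  have f5 : N * (a * 4 ^ J) + 6 * (a * 4 ^ J) ≤ 4 / 5 * (s * q ^ 2) := by
    rw [e4, hεN]
    calc N * (a * m ^ 2) + 6 * (a * m ^ 2) = (N + 6) * (a * m ^ 2) := by ring
      _ ≤ (N + 6) * (ε * (s * q ^ 2)) := by gcongr
      _ = _ := by ring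
  have f6 : 2 * r ≤ 16 * (a * m ^ 3) := by linarith
  have f7 : 16 * ((a : ℝ) * m ^ 3) ≤ 16 * (B * a * 8 ^ J) := by
    rw [e2, mul_assoc (B : ℝ)]
    have : 1 * ((a : ℝ) * m ^ 3) ≤ B * (a * m ^ 3) := by gcongr; linarith
    linarith
  have hprob : P.real ({ω | ¬ ChainGood W lam G₁ B a J K ω} ∪
      {ω | ¬ ChainGood (fun p => W (-p)) lam G₁ B a J K ω} ∪
      {ω | ¬ CoarseGood W lam G₂ B a J K ω}) ≤ C * Real.exp (-c * a) := by
    have hexp : ∀ c', c ≤ c' → Real.exp (-c' * a) ≤ Real.exp (-c * a) := fun c' h => by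
      rw [Real.exp_le_exp]
      have := mul_le_mul_of_nonneg_right h ha0.le
      linarith
    refine (measureReal_union_le _ _).trans ((add_le_add (measureReal_union_le _ _) le_rfl).trans ?_)
    have k1 := (h1 a J (by linarith)).trans
      (mul_le_mul_of_nonneg_left (hexp c₁ (min_le_left _ _)) hC1.le)
    have k2 := (h2 a J (by linarith)).trans (mul_le_mul_of_nonneg_left
      (hexp c₂ ((min_le_right _ _).trans (min_le_left _ _))) hC2.le)
    have k3 := (h3 a J (by linarith)).trans (mul_le_mul_of_nonneg_left
      (hexp c₃ ((min_le_right _ _).trans (min_le_right _ _))) hC3.le)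
    rw [hC, add_mul, add_mul]
    linarith
  refine lt_of_le_of_lt ((measureReal_mono_of_ae hnn fun ω hω hfar => ?_).trans hprob) ?_
  · by_contra hcon
    simp only [Set.mem_union, Set.mem_ofPred_eq, not_or, not_not] at hcon hfar
    obtain ⟨⟨g1, g2⟩, g3⟩ := hcon
    refine absurd hfar (not_lt.2 (iSup₂_le fun γ hγ => ?_))
    rw [EReal.coe_le_coe_iff]
    obtain ⟨u, v, p, hp, hpm, hu0, hv, hu1, hv1, hp1, hd, -⟩ :=
      exists_vertex_of_mem_farPaths hq1 hs1 ht0 hts hq3 hq2 hγ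
    have hw := weight_le_of_good hω g1 g2 g3 hlam.le hG₁.le hG₂.le hB ha1' hp hpm hu0
      (by linarith) (hu1.trans f4) (hv1.trans f4) (hp1.trans f4)
      (D := N * (a * 4 ^ J)) (by positivity) (f5.trans hd)
    rw [hv, ← hE] at hw
    have hloss : (3 + 4 * E) * (a * m) ≤
        G₂ * ((N * (a * 4 ^ J)) ^ 2 / (2 * r + 10 * (B * a * 8 ^ J))) := by
      rw [e4, e2]
      calc (3 + 4 * E) * (a * m)
          = ((3 + 4 * E) * (16 + 10 * B)) * ((a * m ^ 2) ^ 2 / ((16 + 10 * B) * (a * m ^ 3))) := by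
            field_simp
        _ ≤ (G₂ * N ^ 2) * ((a * m ^ 2) ^ 2 / ((16 + 10 * B) * (a * m ^ 3))) := by gcongr
        _ = G₂ * ((N * (a * m ^ 2)) ^ 2 / (16 * (a * m ^ 3) + 10 * (B * a * m ^ 3))) := by
            rw [show 16 * ((a : ℝ) * m ^ 3) + 10 * (B * a * m ^ 3) = (16 + 10 * B) * (a * m ^ 3) by
              ring]
            ring
        _ ≤ _ := by gcongr
    rw [← hm] at hw
    linarith
  -- Since `a ≥ x / 2`, the bound is `C exp(-c x / 2)`; half of the exponent absorbs `C` and gives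
  -- strictness.
  · have hxc : C < Real.exp (c * x / 4) := by
      have h1 : 4 * C / c < x := by linarith
      rw [div_lt_iff₀ hc0] at h1
      have h2 := Real.add_one_le_exp (c * x / 4)
      linarith
    calc C * Real.exp (-c * a) ≤ C * Real.exp (-(c * x / 2)) := by
          refine mul_le_mul_of_nonneg_left (Real.exp_le_exp.2 ?_) hC0.le
          have := mul_le_mul_of_nonneg_left hx2a hc0.le
          linarith
      _ < Real.exp (c * x / 4) * Real.exp (-(c * x / 2)) :=
          mul_lt_mul_of_pos_right hxc (Real.exp_pos _)
      _ = _ := by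
          rw [← Real.exp_add]
          congr 1
          rw [hx]; ring

/-- A geodesic with a large transversal fluctuation has a small weight, so that it is unlikely to be
a path of maximum weight. -/
theorem exists_geodesicFluct_bound {z : ℤ × ℤ} (hz : z.1 = z.2) (hnn : ∀ᵐ ω ∂P, ∀ p, 0 ≤ W (p + z) ω)
    (hL : LowerTail P (fun p => W (p + z)) lam G₁ ρ) (hρ : 0 < ρ) {s₁ c₁ c₂ : ℝ}
    (hc1 : 0 < c₁) (hc2 : 0 < c₂)
    (hfar : ∀ r s t : ℝ, 1 < r → s₁ < s → 0 ≤ t → t ≤ s →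
        P.real {ω | ((2 * lam * r - c₂ * s ^ 2 * r ^ ((1 : ℝ) / 3) : ℝ) : EReal) <
            farWeight (fun p => W (p + z)) r s t ω} < Real.exp (-c₁ * s ^ 3)) :
    ∃ (s₀ : ℝ) (n₀ : ℕ) (c : ℝ), 0 < s₀ ∧ 0 < c ∧
      ∀ (n : ℕ) (s : ℝ), n₀ < n → s₀ < s →
        P.real {ω | s * ((n : ℝ) + 1) ^ ((2 : ℝ) / 3) <
            geodesicFluct W z (((n : ℤ), (n : ℤ)) + z) ω} ≤ Real.exp (-c * s ^ 3) := by
  obtain ⟨c₃, a₀, hc3, ha0, h⟩ := hL (16 / c₂ ^ 3) (by positivity)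
  obtain ⟨n₀, hn₀⟩ := exists_nat_gt (a₀ + 1)
  set c : ℝ := min c₁ c₃ with hc
  have hc0 : 0 < c := lt_min hc1 hc3
  refine ⟨1 + |s₁| + a₀ + 2 / c, n₀, c / 2, by positivity, by positivity, fun n s hn hs => ?_⟩
  have hs1 := le_abs_self s₁
  have hs1' := abs_nonneg s₁
  have h2c : 0 < 2 / c := by positivity
  have hs1 : 1 ≤ s := by linarith
  have hs3 : s ≤ s ^ 3 := le_self_pow₀ hs1 (by norm_num)
  have hn' : (n₀ : ℝ) < n := by exact_mod_cast hn
  set r : ℝ := (n : ℝ) with hr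
  have hr1 : 1 < r := by linarith
  set q : ℝ := r ^ ((1 : ℝ) / 3) with hq
  have hq0 : 0 < q := by positivity
  have hq3 : q ^ 3 = r := cube_rpow_third (by linarith)
  have hF := (hfar r s 0 hr1 (by linarith) le_rfl (by linarith)).le
  -- This choice makes the deviation `a M` equal to `c₂ s² q / 2`, half of the deficit of far paths,
  -- and `(16 / c₂³) a M³` equal to the height `2 r`.
  have hV := h (s ^ 3) (c₂ / 2 * (q / s)) (by linarith) (by positivity) 0 ((n : ℤ), (n : ℤ))
  have eht : ht (((n : ℤ), (n : ℤ)) - 0) = 2 * r := by simp [ht]; ring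
  have eoff : off (((n : ℤ), (n : ℤ)) - 0) = 0 := by simp [off]
  have hs0 : s ≠ 0 := by positivity
  rw [eht, eoff] at hV
  have hV := hV (by linarith) (le_of_eq (by rw [← hq3]; field_simp; norm_num))
    (by rw [abs_zero]; positivity)
  have hexp : ∀ c', c ≤ c' → Real.exp (-c' * s ^ 3) ≤ Real.exp (-c * s ^ 3) := fun c' h => by
    rw [Real.exp_le_exp]
    have := mul_le_mul_of_nonneg_right h (by positivity : 0 ≤ s ^ 3)
    linarith
  refine (measureReal_mono_of_ae hnn fun ω hω hlt => ?_).trans (((measureReal_union_le _ _).trans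
    (add_le_add (hF.trans (hexp _ (min_le_left _ _)))
      (hV.trans (hexp _ (min_le_right _ _))))).trans ?_)
  · by_contra hcon
    simp only [Set.mem_union, Set.mem_ofPred_eq, not_or, not_lt] at hcon hlt
    obtain ⟨g1, g2⟩ := hcon
    -- The supremum of the empty set is `0`, which a nonnegative threshold rules out.
    have hne : {d : ℝ | ∃ γ, IsGeodesic W z (((n : ℤ), (n : ℤ)) + z) ω γ ∧
        d = transFluct γ}.Nonempty := by
      rw [Set.nonempty_iff_ne_empty]
      intro he
      rw [geodesicFluct, he, Real.sSup_empty] at hlt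
      exact absurd hlt (not_lt.2 (by positivity))
    obtain ⟨_, ⟨γ, ⟨hγ, hmax⟩, rfl⟩, hlt⟩ := exists_lt_of_lt_csSup hne hlt
    have hpath : IsPath 0 ((n : ℤ), (n : ℤ)) (γ.map (· + -z)) := by
      simpa using hγ.translate (-z)
    have hw : weight (fun p => W (p + z)) (γ.map (· + -z)) ω = weight W γ ω := by
      rw [weight_translate]; simp
    have hfl : transFluct (γ.map (· + -z)) = transFluct γ := by
      have hdiff : ∀ p : ℤ × ℤ, (((p + -z).1 : ℤ) : ℝ) - ((p + -z).2 : ℤ) = p.1 - p.2 := by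
        intro p
        simp only [Prod.fst_add, Prod.snd_add, Prod.fst_neg, Prod.snd_neg, hz]
        push_cast
        ring
      unfold transFluct
      congr 1
      ext d
      simp only [List.mem_map, Set.mem_ofPred_eq, exists_exists_and_eq_and, hdiff]
    have hmem : γ.map (· + -z) ∈ farPaths r s 0 := by
      refine ⟨0, by simp [antiDiagSegment], _, ?_, hpath, ?_⟩
      · simp only [antiDiagSegment, Set.mem_ofPred_eq, Int.cast_natCast]
        rw [← hr]
        constructor
        · ring
        · simp
      · rw [hfl, add_zero]
        refine lt_of_le_of_lt ?_ hlt
        gcongr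
        linarith
    have h1 : ((weight (fun p => W (p + z)) (γ.map (· + -z)) ω : ℝ) : EReal) ≤
        farWeight (fun p => W (p + z)) r s 0 ω :=
      le_iSup₂ (f := fun γ (_ : γ ∈ farPaths r s 0) =>
        ((weight (fun p => W (p + z)) γ ω : ℝ) : EReal)) _ hmem
    have h2 := h1.trans g1
    rw [EReal.coe_le_coe_iff, hw] at h2
    have hn1 : (1 : ℤ) ≤ n := by
      have : (1 : ℝ) < (n : ℝ) := hr1
      exact_mod_cast this.le
    have h3 : halfPassage (fun p => W (p + z)) 0 ((n : ℤ), (n : ℤ)) ω ≤ weight W γ ω := by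
      refine (lastPassage_mono_right (W := fun p => W (p + z)) hω
        (w := ((n : ℤ), (n : ℤ))) ?_ (by simp [Prod.le_def])).trans ?_
      · simp only [Prod.le_def, Prod.fst_zero, Prod.snd_zero, Prod.fst_sub, Prod.snd_sub]
        omega
      · rw [lastPassage_translate, zero_add]
        exact lastPassage_le (by simp [Prod.le_def]) hmax
    have h4 : s ^ 3 * (c₂ / 2 * (q / s)) = c₂ * s ^ 2 * q / 2 := by field_simp
    have h5 : 0 < c₂ * s ^ 2 * q := by positivity
    rw [h4] at g2
    have h6 : G₁ * (0 ^ 2 / (2 * r)) = 0 := by simp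
    rw [h6] at g2
    linarith
  · have h2 : 2 ≤ Real.exp (c / 2 * s ^ 3) := by
      have h1 : 2 / c ≤ s ^ 3 := by linarith
      rw [div_le_iff₀ hc0] at h1
      have := Real.add_one_le_exp (c / 2 * s ^ 3)
      linarith
    calc Real.exp (-c * s ^ 3) + Real.exp (-c * s ^ 3) = 2 * Real.exp (-c * s ^ 3) := by ring
      _ ≤ Real.exp (c / 2 * s ^ 3) * Real.exp (-c * s ^ 3) := by gcongr
      _ = _ := by
        rw [← Real.exp_add]
        congr 1
        ring

end FarWeight

end LPP

end

/-! ### Both claims; (b) translates the start `(1, 1)` to the origin, so the endpoint `(m + 1, m +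
1)` becomes `(m, m)`. -/

theorem theoremt {Ω : Type*} [MeasurableSpace Ω] (P : Measure Ω) [IsProbabilityMeasure P]
    (ν : Measure ℝ) (W : ℤ × ℤ → Ω → ℝ) (hW : LPP.IsEnvironment P ν W)
    (hconc : LPP.StrongConcavity P W) (hdev : LPP.DeviationEstimates P W) :
    (∃ r₀ s₀ c c₂ : ℝ, 0 < r₀ ∧ 0 < s₀ ∧ 0 < c ∧ 0 < c₂ ∧
      ∀ r s t : ℝ, r₀ < r → s₀ < s → 0 ≤ t → t ≤ s →
        P.real {ω | ((LPP.growthRate P W * r - c₂ * s ^ 2 * r ^ ((1 : ℝ) / 3) : ℝ) : EReal) <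
            LPP.farWeight W r s t ω} < Real.exp (-c * s ^ 3)) ∧
    (∃ (s₀ : ℝ) (n₀ : ℕ) (c : ℝ), 0 < s₀ ∧ 0 < c ∧
      ∀ (n : ℕ) (s : ℝ), n₀ < n → s₀ < s →
        P.real {ω | s * (n : ℝ) ^ ((2 : ℝ) / 3) <
            LPP.geodesicFluct W (1, 1) ((n : ℤ), (n : ℤ)) ω} ≤ Real.exp (-c * s ^ 3)) := by
  obtain ⟨G₁, ρ, hG₁, hρ, -, hL⟩ := LPP.exists_lowerTail hW hconc hdev
  obtain ⟨G₂, hG₂, hU⟩ := LPP.exists_upperTail hW hconc hdev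
  have hlam : 0 < LPP.growthRate P W / 2 := half_pos (LPP.growthRate_pos hW hconc)
  have far : ∀ V, LPP.IsEnvironment P ν V → _ := fun V hV =>
    LPP.exists_farWeight_bound hV.ae_nonneg hlam hG₁ hG₂ hρ (hL V hV)
      (hL _ (hV.precomp neg_injective)) (hU V hV)
  constructor
  · obtain ⟨s₀, c, c₂, hs₀, hc, hc₂, h⟩ := far W hW
    refine ⟨1, s₀, c, c₂, one_pos, hs₀, hc, hc₂, fun r s t hr hs ht hts => ?_⟩
    have := h r s t hr hs ht hts
    rwa [mul_div_cancel₀ _ two_ne_zero] at this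
  · have hW' := hW.precomp (add_left_injective ((1, 1) : ℤ × ℤ))
    obtain ⟨s₁, c₁, c₂, -, hc₁, hc₂, h⟩ := far _ hW'
    obtain ⟨s₀, n₀, c, hs₀, hc, hb⟩ := LPP.exists_geodesicFluct_bound rfl hW'.ae_nonneg
      (hL _ hW') hρ hc₁ hc₂ h
    refine ⟨s₀, n₀ + 1, c, hs₀, hc, fun n s hn hs => ?_⟩
    obtain ⟨m, rfl⟩ : ∃ m, n = m + 1 := ⟨n - 1, by omega⟩
    have := hb m s (by omega) hs
    simpa using this
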